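/- **Theorem 2.** Let $\alpha\in[0,1)$, $\theta>-\alpha$, let $J\ge 1$ and $m\ge 0$ be integers, and let $\nu$ be a non-atomic probability measure on a measurable space $\mathcal V$ with measurable diagonal. Let $P\sim\mathrm{PYP}(\alpha,\theta,\nu)$ be a Pitman–Yor process, i.e. a random measure with the law of $\sum_{j\ge1}P_j\delta_{Y_j}$, where $P_j=V_j\prod_{i<j}(1-V_i)$, the $V_i\sim\mathrm{Beta}(1-\alpha,\theta+i\alpha)$ are independent, and the $Y_j$ are i.i.d. with distribution $\nu$ and independent of the $V_i$. Conditionally on $P$, let $X_1,\dots,X_{m+1}$ be i.i.d. with distribution $P$. Let $h:\mathcal V\to\{1,\dots,J\}$ be a perfectly random hash function drawn independently of the sample: conditionally on $(X_1,\dots,X_{m+1})$, the hash values of distinct tokens (fixed ones, or measurable functions of the sample such as the $X_i$ themselves) are i.i.d. uniform on $\{1,\dots,J\}$. Put $$f_{X_{m+1}}=\sum_{i=1}^m \mathbf 1\{X_i=X_{m+1}\},\qquad C_{h(X_{m+1})}=\sum_{i=1}^m\mathbf 1\{h(X_i)=h(X_{m+1})\}.$$ Write $(a)_{(n)}=\prod_{i=0}^{n-1}(a+i)$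 and $\mathscr C(n,k;\alpha)=\frac1{k!}\sum_{i=0}^k\binom ki(-1)^i(-i\alpha)_{(n)}$, and let $$p_{\alpha,\theta}(n,k)=\frac{(\theta/\alpha)_{(k)}}{(\theta)_{(n)}}\,\mathscr C(n,k;\alpha),\qquad G_{K_n}(t;\alpha,\theta)=\sum_{k=0}^n t^k\,p_{\alpha,\theta}(n,k),$$ where for $\alpha=0$ the product $(\theta/\alpha)_{(k)}\mathscr C(n,k;\alpha)$ is read as its limit $\theta^k|s(n,k)|$ ($|s(n,k)|$ being the unsigned Stirling numbers of the first kind), and for $\theta=0$, $n\ge1$, the common factor $\theta$ of $(\theta/\alpha)_{(k)}$ and $(\theta)_{(n)}$ is cancelled. Then the number $K_{m+1}$ of distinct values among $X_1,\dots,X_{m+1}$ satisfies $\Pr[K_{m+1}=k]=p_{\alpha,\theta}(m+1,k)$ for all $k\ge0$, so that $G_{K_{m+1}}(\cdot;\alpha,\theta)$ is its probability generating function. Moreover, for every $c$ with $\Pr[C_{h(X_{m+1})}=c]>0$ and every integer $l\ge0$, $$\Pr\bigl[f_{X_{m+1}}=l\,\big|\,C_{h(X_{m+1})}=c\bigr]=\frac{\theta}{J}\binom{c}{l}\frac{(\theta+\alpha)_{(m-l)}}{(\theta)_{(m+1)}}(1-\alpha)_{(l)}\;\frac{\sum_{i=0}^{m-c}\binom{m-c}{i}(-1)^{m-c-i}\,G_{K_{m-l-i}}\!\left(\tfrac1J;\alpha,\theta+\alpha\right)}{\sum_{i=0}^{m-c}\binom{m-c}{i}(-1)^{m-c-i}\,G_{K_{m-i+1}}\!\left(\tfrac1J;\alpha,\theta\right)},$$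 where the denominator of the last fraction is nonzero, for $\theta=0$ the ratio $\theta/(\theta)_{(m+1)}$ is read as $1/(1)_{(m)}$, and for $l>c$ the right-hand side is $0$. -/

import Mathlib

open MeasureTheory ProbabilityTheory
open scoped ENNReal

noncomputable section

namespace PYPSketch

/-- The rising factorial `(a)_(n) = a (a + 1) ⋯ (a + n - 1)`. -/
def rising (a : ℝ) (n : ℕ) : ℝ := ∏ i ∈ Finset.range n, (a + i)

/-- The generalized factorial coefficient
`𝒞(n, k; α) = (1 / k!) ∑_{i ≤ k} C(k, i) (-1)^i (-i α)_(n)`. -/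
def genFactCoeff (n k : ℕ) (α : ℝ) : ℝ :=
  (k.factorial : ℝ)⁻¹ *
    ∑ i ∈ Finset.range (k + 1), (k.choose i : ℝ) * (-1) ^ i * rising (-(i * α)) n

/-- The distribution of the number `K_n` of distinct values in a sample of size `n`,
`Pr[K_n = k] = (θ/α)_(k) / (θ)_(n) * 𝒞(n, k; α)`. At the two boundary values of the parameters
where this expression reads `0 / 0` it is replaced by its limit:
for `α = 0`, `(θ/α)_(k) 𝒞(n, k; α)` becomes `θ ^ k |s(n, k)|`, with `|s(n, k)|` the unsigned
Stirling numbers of the first kind; for `θ = 0` (and `n ≥ 1`), the common factor `θ` of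
`(θ/α)_(k)` and `(θ)_(n)` is cancelled. -/
def distinctPMF (α θ : ℝ) (n k : ℕ) : ℝ :=
  if α = 0 then
    θ ^ k / rising θ n * (n.stirlingFirst k : ℝ)
  else if θ = 0 ∧ n ≠ 0 then
    α⁻¹ * rising 1 (k - 1) / rising 1 (n - 1) * genFactCoeff n k α
  else
    rising (θ / α) k / rising θ n * genFactCoeff n k α

/-- The probability generating function `G_{K_n}(t; α, θ) = ∑_k t^k Pr[K_n = k]`. -/
def distinctPGF (n : ℕ) (t α θ : ℝ) : ℝ :=
  ∑ k ∈ Finset.range (n + 1), t ^ k * distinctPMF α θ n k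

/-- The factor `θ / (θ)_(n + 1)`, whose common factor `θ` is cancelled when `θ = 0`. -/
def thetaFactor (θ : ℝ) (n : ℕ) : ℝ :=
  if θ = 0 then 1 / rising 1 n else θ / rising θ (n + 1)

section PitmanYor

variable {V : Type*} [MeasurableSpace V]

/-- The discrete measure `∑_j P_j δ_{Y_j}` with stick-breaking weights
`P_j = W_j ∏_{i < j} (1 - W_i)` (indices start at `0`). -/
def stickBreaking (p : (ℕ → ℝ) × (ℕ → V)) : Measure V :=
  Measure.sum fun j =>
    ENNReal.ofReal (p.1 j * ∏ i ∈ Finset.range j, (1 - p.1 i)) • Measure.dirac (p.2 j)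

theorem measurable_stickBreaking :
    Measurable (stickBreaking : (ℕ → ℝ) × (ℕ → V) → Measure V) := by
  refine Measure.measurable_of_measurable_coe _ fun s hs => ?_
  simp only [stickBreaking, Measure.sum_apply _ hs, Measure.smul_apply, smul_eq_mul]
  refine Measurable.tsum fun j => Measurable.mul ?_ ?_
  · fun_prop
  · exact (Measure.measurable_coe hs).comp (Measure.measurable_dirac.comp (by fun_prop))

/-- The law `PYP(α, θ, ν)` of the Pitman–Yor process on `V`: the law of the random measure
`∑_j P_j δ_{Y_j}`, where the sticks `W_0, W_1, …` are independent, `W_i` has the distribution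
`Beta(1 - α, θ + (i + 1) α)` (indices start at `0`), and, independently of the sticks,
`Y_0, Y_1, …` are i.i.d. with distribution `ν`. -/
def pypLaw (α θ : ℝ) (ν : Measure V) : Measure (Measure V) :=
  ((Measure.infinitePi fun i : ℕ => betaMeasure (1 - α) (θ + (i + 1) * α)).prod
    (Measure.infinitePi fun _ : ℕ => ν)).map stickBreaking

variable {Ω : Type*} [MeasurableSpace Ω]

/-- `X_1, …, X_n` is a random sample from the random measure `P`: conditionally on `P`, the `X_i`
are i.i.d. with distribution `P`. -/
def IsSampleFrom {n : ℕ} (μ : Measure Ω) (X : Fin n → Ω → V) (P : Ω → Measure V) : Prop :=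
  (∀ i, Measurable (X i)) ∧
  ∀ (B : Set (Measure V)) (A : Fin n → Set V), MeasurableSet B → (∀ i, MeasurableSet (A i)) →
    μ {ω | P ω ∈ B ∧ ∀ i, X i ω ∈ A i} = ∫⁻ ω in {ω | P ω ∈ B}, ∏ i, P ω (A i) ∂μ

/-- The random function `h : V → [J]` is a perfectly random hash function drawn independently of
the random element `X`: conditionally on `X`, the hash values of distinct tokens are i.i.d.
uniform on the `J` buckets. The tokens are allowed to be functions `z_i(X)` of `X`, such as
the observations themselves; constant functions `z_i` give fixed tokens. -/
def IsPerfectlyRandomHash {S : Type*} [MeasurableSpace S] {J : ℕ} (μ : Measure Ω) (X : Ω → S)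
    (h : Ω → V → Fin J) : Prop :=
  (∀ z : S → V, Measurable z → Measurable fun ω => h ω (z (X ω))) ∧
  ∀ (k : ℕ) (z : Fin k → S → V) (A : Set S), (∀ i, Measurable (z i)) → MeasurableSet A →
    (∀ s ∈ A, Function.Injective fun i => z i s) →
    ∀ j : Fin k → Fin J,
      μ {ω | X ω ∈ A ∧ ∀ i, h ω (z i (X ω)) = j i} = μ {ω | X ω ∈ A} * (J : ℝ≥0∞)⁻¹ ^ k

end PitmanYor

/-- The frequency `f_v = ∑_{i ≤ m} 1{x_i = v}` of the token `v` in the stream `x_1, …, x_m`. -/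
def freq {V : Type*} {m : ℕ} (x : Fin m → V) (v : V) : ℕ :=
  ∑ i, Set.indicator {x i} (fun _ => 1) v

/-- The hashed frequency `C_{h(v)} = ∑_{i ≤ m} 1{h(x_i) = h(v)}` of the bucket of `v`. -/
def bucketCount {V : Type*} {m J : ℕ} (h : V → Fin J) (x : Fin m → V) (v : V) : ℕ :=
  ∑ i, Set.indicator {h (x i)} (fun _ => 1) (h v)

end PYPSketch

end

/-!
Write a sample as a partition `s` of its index set, together with the values on the blocks. Let
`D_θ(n)` be the expected sum of `∏_b P_{e b} ^ {n_b}` over the families `e` of distinct indices, for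
block sizes `n_b ≥ 1`. Splitting off the first stick, and according to the block (if any) that uses
the first atom, expresses `D_θ` by `D_{θ + α}` for `n` and for `n` with one block removed. The
product formula for the exchangeable partition probabilities satisfies the same recursion, and, by
induction on the number of blocks, the difference `f_r` of the two expressions at the parameter
`θ + r α` satisfies `f_r = a_r f_{r + 1}` with `0 ≤ a_r ≤ 1 - c / (r + 1)` for a constant `c > 0`.
As the `f_r` are bounded and the harmonic series diverges, `f_0 = 0`. The recursion of the
generalized Stirling numbers then gives the law of the number of blocks.

The partition probabilities are consistent under restriction to subsets of the index set, and
deleting the block of a given point turns the parameter `θ` into `θ + α`. Given the partition, a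
set `R` of indices is hashed into the bucket of `X_{m + 1}` with probability `J⁻¹` to the number of
blocks that `R` meets outside the block of `X_{m + 1}`, so that the probability of this event is a
value at `1 / J` of the generating function of a number of distinct values. The alternating sums
come from inclusion–exclusion over `R`.
-/

namespace PYPSketch

section Rising

@[simp]
theorem rising_zero (a : ℝ) : rising a 0 = 1 := by simp [rising]

theorem rising_succ (a : ℝ) (n : ℕ) : rising a (n + 1) = rising a n * (a + n) :=
  Finset.prod_range_succ _ _

@[simp]
theorem rising_one (a : ℝ) : rising a 1 = a := by simp [rising]

theorem rising_add (a : ℝ) (m n : ℕ) : rising a (m + n) = rising a m * rising (a + m) n := by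
  simp [rising, Finset.prod_range_add, add_assoc]

theorem rising_succ_left (a : ℝ) (n : ℕ) : rising a (n + 1) = a * rising (a + 1) n := by
  rw [add_comm, rising_add, rising_one, Nat.cast_one]

theorem rising_eq_rising_pred_mul {n : ℕ} (hn : n ≠ 0) (a : ℝ) :
    rising a n = rising a (n - 1) * (a + n - 1) := by
  obtain ⟨k, rfl⟩ := Nat.exists_eq_succ_of_ne_zero hn
  rw [Nat.succ_eq_add_one, rising_succ, Nat.add_sub_cancel]
  push_cast
  ring

theorem rising_pos {a : ℝ} (ha : 0 < a) (n : ℕ) : 0 < rising a n :=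
  Finset.prod_pos fun i _ => by positivity

theorem rising_mono {a b : ℝ} (ha : 0 ≤ a) (hab : a ≤ b) (n : ℕ) : rising a n ≤ rising b n :=
  Finset.prod_le_prod (fun i _ => by positivity) fun i _ => by linarith

theorem Gamma_add_natCast {a : ℝ} (ha : 0 < a) (n : ℕ) :
    Real.Gamma (a + n) = rising a n * Real.Gamma a := by
  induction n with
  | zero => simp
  | succ n ih =>
    rw [Nat.cast_succ, ← add_assoc, Real.Gamma_add_one (by positivity), ih, rising_succ]
    ring

end Rising

section BetaMoments

variable {p q : ℝ}

theorem beta_add_natCast (hp : 0 < p) (hq : 0 < q) (a b : ℕ) :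
    beta (p + a) (q + b) = rising p a * rising q b / rising (p + q) (a + b) * beta p q := by
  have hsum : p + a + (q + b) = p + q + ((a + b : ℕ) : ℝ) := by push_cast; ring
  have := (rising_pos (add_pos hp hq) (a + b)).ne'
  have := (Real.Gamma_pos_of_pos (add_pos hp hq)).ne'
  rw [beta, beta, hsum, Gamma_add_natCast hp, Gamma_add_natCast hq,
    Gamma_add_natCast (add_pos hp hq)]
  field_simp

theorem measurable_betaPDF (p q : ℝ) : Measurable (betaPDF p q) :=
  (measurable_betaPDFReal p q).ennreal_ofReal

theorem betaPDF_mul_pow_mul_pow (hp : 0 < p) (hq : 0 < q) (a b : ℕ) (x : ℝ) :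
    betaPDF p q x * (ENNReal.ofReal x ^ a * ENNReal.ofReal (1 - x) ^ b) =
      ENNReal.ofReal (rising p a * rising q b / rising (p + q) (a + b)) *
        betaPDF (p + a) (q + b) x := by
  by_cases hx : 0 < x ∧ x < 1
  · obtain ⟨h0, h1⟩ := hx
    have h1' : 0 < 1 - x := sub_pos.2 h1
    have := beta_pos hp hq
    have := rising_pos hp a
    have := rising_pos hq b
    have := rising_pos (add_pos hp hq) (a + b)
    rw [betaPDF_of_pos_lt_one h0 h1, betaPDF_of_pos_lt_one h0 h1,
      ← ENNReal.ofReal_pow h0.le, ← ENNReal.ofReal_pow h1'.le,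
      ← ENNReal.ofReal_mul (by positivity), ← ENNReal.ofReal_mul (by positivity),
      ← ENNReal.ofReal_mul (by positivity), beta_add_natCast hp hq,
      add_sub_right_comm p, add_sub_right_comm q,
      Real.rpow_add_natCast h0.ne', Real.rpow_add_natCast h1'.ne']
    congr 1
    field_simp
  · simp [betaPDF_eq, hx]

theorem lintegral_betaMeasure_pow_mul_pow (hp : 0 < p) (hq : 0 < q) (a b : ℕ) :
    ∫⁻ x, ENNReal.ofReal x ^ a * ENNReal.ofReal (1 - x) ^ b ∂betaMeasure p q =
      ENNReal.ofReal (rising p a * rising q b / rising (p + q) (a + b)) := by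
  rw [betaMeasure, lintegral_withDensity_eq_lintegral_mul _ (measurable_betaPDF p q)
    (by fun_prop)]
  simp_rw [Pi.mul_apply, betaPDF_mul_pow_mul_pow hp hq]
  rw [lintegral_const_mul _ (measurable_betaPDF _ _),
    lintegral_betaPDF_eq_one (by positivity) (by positivity), mul_one]

theorem ae_betaMeasure_mem_Ioo (p q : ℝ) : ∀ᵐ x ∂betaMeasure p q, x ∈ Set.Ioo (0 : ℝ) 1 := by
  rw [betaMeasure, ae_withDensity_iff (measurable_betaPDF p q)]
  refine .of_forall fun x hx => by_contra fun h => hx ?_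
  rw [Set.mem_Ioo] at h
  simp [betaPDF_eq, h]

end BetaMoments

section HeadTail

variable {E : Type*} [MeasurableSpace E] (μ : ℕ → Measure E) [∀ i, IsProbabilityMeasure (μ i)]

theorem indepFun_head_tail :
    IndepFun (fun v => v 0) (fun v i => v (i + 1)) (Measure.infinitePi μ) := by
  let m : ℕ → MeasurableSpace (ℕ → E) := fun i => MeasurableSpace.comap (fun v => v i) inferInstance
  have hm : ∀ i, m i ≤ MeasurableSpace.pi := fun i => (measurable_pi_apply i).comap_le
  have hindep : iIndep m (Measure.infinitePi μ) :=
    iIndepFun_infinitePi (X := fun _ x => x) fun _ => measurable_id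
  have hdisj : Disjoint ({0} : Set ℕ) {0}ᶜ := disjoint_compl_right
  refine indep_of_indep_of_le_right (indep_of_indep_of_le_left
    (indep_iSup_of_disjoint hm hindep hdisj) (le_iSup₂_of_le 0 rfl le_rfl)) ?_
  refine (@measurable_pi_iff _ _ _ (⨆ i ∈ ({0} : Set ℕ)ᶜ, m i) _ _).2 (fun i => ?_) |>.comap_le
  exact measurable_iff_comap_le.2 (le_iSup₂_of_le (i + 1) i.succ_ne_zero le_rfl)

theorem measurePreserving_head_tail :
    MeasurePreserving (fun v : ℕ → E => (v 0, fun i => v (i + 1))) (Measure.infinitePi μ)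
      ((μ 0).prod (Measure.infinitePi fun i => μ (i + 1))) where
  measurable := by fun_prop
  map_eq := by
    rw [(indepFun_head_tail μ).map_prod_eq_prod_map_map
      (Measurable.aemeasurable (by fun_prop)) (Measurable.aemeasurable (by fun_prop)),
      Measure.infinitePi_map_eval, Measure.map_infinitePi_infinitePi_of_inj (add_left_injective 1)]

end HeadTail

/-- The range `α ∈ [0, 1)`, `θ > -α` of the parameters of a Pitman–Yor process. -/
structure IsPitmanYorParam (α θ : ℝ) : Prop where
  nonneg : 0 ≤ α
  lt_one : α < 1
  neg_lt : -α < θ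

namespace IsPitmanYorParam

variable {α θ θ' : ℝ} (h : IsPitmanYorParam α θ)

include h

theorem mono (hθ : θ ≤ θ') : IsPitmanYorParam α θ' := ⟨h.nonneg, h.lt_one, h.neg_lt.trans_le hθ⟩

theorem add_self : IsPitmanYorParam α (θ + α) := h.mono (le_add_of_nonneg_right h.nonneg)

theorem one_sub_pos : 0 < 1 - α := sub_pos.2 h.lt_one

theorem add_self_pos : 0 < θ + α := neg_lt_iff_pos_add.1 h.neg_lt

theorem add_one_pos : 0 < θ + 1 := by linarith [h.lt_one, h.neg_lt]

theorem add_mul_pos (i : ℕ) : 0 < θ + (i + 1) * α := by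
  nlinarith [h.add_self_pos, mul_nonneg (Nat.cast_nonneg (α := ℝ) i) h.nonneg]

end IsPitmanYorParam

section Sticks

/-- The law of the sticks `W_0, W_1, …` of the Pitman–Yor process. -/
noncomputable def stickLaw (α θ : ℝ) : Measure (ℕ → ℝ) :=
  Measure.infinitePi fun i : ℕ => betaMeasure (1 - α) (θ + (i + 1) * α)

/-- The stick-breaking weight `P_j = W_j ∏_{i < j} (1 - W_i)`, as an extended nonnegative real. -/
noncomputable def stickWeight (v : ℕ → ℝ) (j : ℕ) : ℝ≥0∞ :=
  ENNReal.ofReal (v j * ∏ i ∈ Finset.range j, (1 - v i))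

variable {α θ : ℝ}

theorem IsPitmanYorParam.isProbabilityMeasure_stick (h : IsPitmanYorParam α θ) (i : ℕ) :
    IsProbabilityMeasure (betaMeasure (1 - α) (θ + (i + 1) * α)) :=
  isProbabilityMeasureBeta h.one_sub_pos (h.add_mul_pos i)

theorem IsPitmanYorParam.isProbabilityMeasure_stickLaw (h : IsPitmanYorParam α θ) :
    IsProbabilityMeasure (stickLaw α θ) := by
  have := h.isProbabilityMeasure_stick
  unfold stickLaw
  infer_instance

theorem measurePreserving_stickLaw_head_tail (h : IsPitmanYorParam α θ) :
    MeasurePreserving (fun v : ℕ → ℝ => (v 0, fun i => v (i + 1))) (stickLaw α θ)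
      ((betaMeasure (1 - α) (θ + α)).prod (stickLaw α (θ + α))) := by
  have := h.isProbabilityMeasure_stick
  have hhead : θ + α = θ + ((0 : ℕ) + 1) * α := by simp
  have htail : stickLaw α (θ + α) =
      Measure.infinitePi fun i : ℕ => betaMeasure (1 - α) (θ + ((i + 1 : ℕ) + 1) * α) := by
    unfold stickLaw
    congr! 3
    push_cast
    ring
  rw [htail, hhead]
  exact measurePreserving_head_tail fun i : ℕ => betaMeasure (1 - α) (θ + (i + 1) * α)

theorem lintegral_stickLaw_head_tail (h : IsPitmanYorParam α θ) (a b : ℕ)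
    {g : (ℕ → ℝ) → ℝ≥0∞} (hg : Measurable g) :
    ∫⁻ v, ENNReal.ofReal (v 0) ^ a * ENNReal.ofReal (1 - v 0) ^ b * g (fun i => v (i + 1))
        ∂stickLaw α θ =
      ENNReal.ofReal (rising (1 - α) a * rising (θ + α) b / rising (θ + 1) (a + b)) *
        ∫⁻ v, g v ∂stickLaw α (θ + α) := by
  have := h.add_self.isProbabilityMeasure_stickLaw
  have hsum : θ + 1 = 1 - α + (θ + α) := by ring
  rw [hsum, ← lintegral_betaMeasure_pow_mul_pow h.one_sub_pos h.add_self_pos,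
    ← lintegral_prod_mul (by fun_prop) hg.aemeasurable]
  exact (measurePreserving_stickLaw_head_tail h).lintegral_comp
    (f := fun p => ENNReal.ofReal p.1 ^ a * ENNReal.ofReal (1 - p.1) ^ b * g p.2) (by fun_prop)

theorem ae_stickLaw_mem_Ioo (h : IsPitmanYorParam α θ) :
    ∀ᵐ v ∂stickLaw α θ, ∀ i, v i ∈ Set.Ioo (0 : ℝ) 1 := by
  have := h.isProbabilityMeasure_stick
  exact ae_all_iff.2 fun i => (measurePreserving_eval_infinitePi _ i).quasiMeasurePreserving.ae
    (ae_betaMeasure_mem_Ioo _ _)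

@[fun_prop]
theorem measurable_stickWeight (j : ℕ) : Measurable fun v => stickWeight v j := by
  unfold stickWeight
  fun_prop

theorem stickWeight_zero (v : ℕ → ℝ) : stickWeight v 0 = ENNReal.ofReal (v 0) := by
  simp [stickWeight]

theorem stickWeight_succ {v : ℕ → ℝ} (hv : v 0 ≤ 1) (j : ℕ) :
    stickWeight v (j + 1) = ENNReal.ofReal (1 - v 0) * stickWeight (fun i => v (i + 1)) j := by
  rw [stickWeight, stickWeight, ← ENNReal.ofReal_mul (sub_nonneg.2 hv), Finset.prod_range_succ']
  congr 1
  ring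

theorem tsum_stickWeight_le_one {v : ℕ → ℝ} (hv : ∀ i, v i ∈ Set.Ioo (0 : ℝ) 1) :
    ∑' j, stickWeight v j ≤ 1 := by
  have hprod : ∀ N, 0 ≤ ∏ i ∈ Finset.range N, (1 - v i) :=
    fun N => Finset.prod_nonneg fun i _ => sub_nonneg.2 (hv i).2.le
  have hpartial : ∀ N, ∑ j ∈ Finset.range N, v j * ∏ i ∈ Finset.range j, (1 - v i) =
      1 - ∏ i ∈ Finset.range N, (1 - v i) := fun N => by
    induction N with
    | zero => simp
    | succ N ih => rw [Finset.sum_range_succ, Finset.prod_range_succ, ih]; ring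
  refine ENNReal.tsum_le_of_sum_range_le fun N => ?_
  simp_rw [stickWeight]
  rw [← ENNReal.ofReal_sum_of_nonneg fun j _ => mul_nonneg (hv j).1.le (hprod j), hpartial,
    ENNReal.ofReal_le_one]
  linarith [hprod N]

end Sticks

section Embeddings

variable {β : Type*}

theorem exists_embedding_succ_eq {e : β ↪ ℕ} (he : ∀ x, e x ≠ 0) :
    ∃ e' : β ↪ ℕ, ∀ x, e' x + 1 = e x := by
  have hpred : ∀ x, e x - 1 + 1 = e x := fun x => Nat.sub_one_add_one (he x)
  refine ⟨⟨fun x => e x - 1, fun x y hxy => e.injective ?_⟩, hpred⟩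
  rw [← hpred x, ← hpred y]
  exact congrArg (· + 1) hxy

/-- The embedding that never takes the value `0` and is otherwise the shift of `e`. -/
def shiftEmbedding (e : β ↪ ℕ) : β ↪ ℕ := e.trans ⟨Nat.succ, Nat.succ_injective⟩

@[simp]
theorem shiftEmbedding_apply (e : β ↪ ℕ) (x : β) : shiftEmbedding e x = e x + 1 := rfl

theorem shiftEmbedding_injective : Function.Injective (shiftEmbedding (β := β)) := fun _ _ h =>
  DFunLike.ext _ _ fun x => Nat.succ_injective (DFunLike.congr_fun h x)

theorem range_shiftEmbedding : Set.range (shiftEmbedding (β := β)) = {e | ∀ x, e x ≠ 0} := by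
  ext e
  refine ⟨?_, fun he => ?_⟩
  · rintro ⟨e, rfl⟩ x
    exact Nat.succ_ne_zero _
  · obtain ⟨e', he'⟩ := exists_embedding_succ_eq he
    exact ⟨e', DFunLike.ext _ _ he'⟩

theorem indicator_ne_zero_add_sum_indicator [Fintype β] (F : (β ↪ ℕ) → ℝ≥0∞) (e : β ↪ ℕ) :
    {e : β ↪ ℕ | ∀ x, e x ≠ 0}.indicator F e + ∑ b, {e : β ↪ ℕ | e b = 0}.indicator F e = F e := by
  by_cases he : ∀ x, e x ≠ 0
  · simp [Set.indicator, he]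
  · push Not at he
    obtain ⟨b, hb⟩ := he
    have hmem : e ∉ {e : β ↪ ℕ | ∀ x, e x ≠ 0} := fun h => h b hb
    rw [Set.indicator_of_notMem hmem, zero_add, Finset.sum_eq_single_of_mem b
      (Finset.mem_univ b)]
    · exact Set.indicator_of_mem (s := {e : β ↪ ℕ | e b = 0}) hb F
    · intro b' _ hne
      have hb' : e ∉ {e : β ↪ ℕ | e b' = 0} := fun h => hne (e.injective (Eq.trans h hb.symm))
      exact Set.indicator_of_notMem hb' F

variable [DecidableEq β]

/-- The embedding that sends `b` to `0` and is otherwise the shift of `e`. -/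
def insertZero (b : β) (e : {x // x ≠ b} ↪ ℕ) : β ↪ ℕ :=
  (Equiv.optionSubtypeNe b).symm.toEmbedding.trans
    ((shiftEmbedding e).optionElim 0 fun ⟨_, h⟩ => Nat.succ_ne_zero _ h)

@[simp]
theorem insertZero_self (b : β) (e : {x // x ≠ b} ↪ ℕ) : insertZero b e b = 0 := by
  simp [insertZero]

@[simp]
theorem insertZero_coe (b : β) (e : {x // x ≠ b} ↪ ℕ) (x : {x // x ≠ b}) :
    insertZero b e x = e x + 1 := by
  simp [insertZero, Equiv.optionSubtypeNe_symm_of_ne x.2]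

theorem insertZero_injective (b : β) : Function.Injective (insertZero b) := fun _ _ h =>
  DFunLike.ext _ _ fun x => by simpa using DFunLike.congr_fun h (x : β)

theorem range_insertZero (b : β) : Set.range (insertZero b) = {e | e b = 0} := by
  ext e
  refine ⟨?_, fun he => ?_⟩
  · rintro ⟨e, rfl⟩
    exact insertZero_self b e
  · have hne : ∀ x : {x // x ≠ b}, (Function.Embedding.subtype _).trans e x ≠ 0 := fun x hx =>
      x.2 (e.injective (hx.trans (Eq.symm he)))
    obtain ⟨e', he'⟩ := exists_embedding_succ_eq hne
    refine ⟨e', DFunLike.ext _ _ fun x => ?_⟩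
    by_cases hx : x = b
    · rw [hx, insertZero_self]
      exact Eq.symm he
    · exact (insertZero_coe b e' ⟨x, hx⟩).trans (he' ⟨x, hx⟩)

theorem tsum_embedding_nat [Fintype β] (F : (β ↪ ℕ) → ℝ≥0∞) :
    ∑' e, F e = ∑' e, F (shiftEmbedding e) + ∑ b, ∑' e, F (insertZero b e) := by
  simp_rw [← tsum_range F shiftEmbedding_injective, ← tsum_range F (insertZero_injective _),
    tsum_subtype, range_shiftEmbedding, range_insertZero]
  rw [← Summable.tsum_finsetSum fun _ _ => ENNReal.summable, ← ENNReal.tsum_add]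
  exact tsum_congr fun e => (indicator_ne_zero_add_sum_indicator F e).symm

end Embeddings

section DistinctSum

variable {β : Type*} [Fintype β]

/-- The sum `∑ ∏_b w_{e b} ^ {n b}` over the families `e` of distinct indices; for the weights of a
discrete random measure its expectation is the probability of a partition with block sizes `n`. -/
noncomputable def distinctSum (w : ℕ → ℝ≥0∞) (n : β → ℕ) : ℝ≥0∞ :=
  ∑' e : β ↪ ℕ, ∏ b, w (e b) ^ n b

theorem distinctSum_of_isEmpty [IsEmpty β] (w : ℕ → ℝ≥0∞) (n : β → ℕ) : distinctSum w n = 1 := by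
  simp [distinctSum]

theorem distinctSum_const_mul (c : ℝ≥0∞) (w : ℕ → ℝ≥0∞) (n : β → ℕ) :
    distinctSum (fun j => c * w j) n = c ^ (∑ b, n b) * distinctSum w n := by
  simp_rw [distinctSum, mul_pow, Finset.prod_mul_distrib, Finset.prod_pow_eq_pow_sum,
    ENNReal.tsum_mul_left]

theorem distinctSum_eq_shift_add [DecidableEq β] (w : ℕ → ℝ≥0∞) (n : β → ℕ) :
    distinctSum w n = distinctSum (fun j => w (j + 1)) n +
      ∑ b, w 0 ^ n b * distinctSum (fun j => w (j + 1)) fun x : {x // x ≠ b} => n x := by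
  rw [distinctSum, tsum_embedding_nat]
  refine congrArg₂ _ rfl (Finset.sum_congr rfl fun b _ => ?_)
  rw [distinctSum, ← ENNReal.tsum_mul_left]
  simp_rw [fun e : {x // x ≠ b} ↪ ℕ =>
    Fintype.prod_eq_mul_prod_subtype_ne (fun x => w (insertZero b e x) ^ n x) b,
    insertZero_self, insertZero_coe]

theorem measurable_distinctSum {Ω : Type*} [MeasurableSpace Ω] {w : Ω → ℕ → ℝ≥0∞}
    (hw : ∀ j, Measurable fun ω => w ω j) (n : β → ℕ) :
    Measurable fun ω => distinctSum (w ω) n := by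
  have : Countable (β ↪ ℕ) := DFunLike.coe_injective.countable
  exact Measurable.tsum fun e => Finset.measurable_fun_prod _ fun b _ => (hw _).pow_const _

theorem prod_tsum_eq_tsum_prod_fin {k : ℕ} (f : Fin k → ℕ → ℝ≥0∞) :
    ∏ i, ∑' j, f i j = ∑' I : Fin k → ℕ, ∏ i, f i (I i) := by
  induction k with
  | zero => simp
  | succ k ih =>
    rw [Fin.prod_univ_succ, ih, ← (Fin.consEquiv fun _ => ℕ).tsum_eq, ENNReal.tsum_prod',
      ← ENNReal.tsum_mul_right]
    simp_rw [← ENNReal.tsum_mul_left, Fin.prod_univ_succ]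
    rfl

theorem prod_tsum_eq_tsum_prod (f : β → ℕ → ℝ≥0∞) :
    ∏ b, ∑' j, f b j = ∑' I : β → ℕ, ∏ b, f b (I b) := by
  let e := (Fintype.equivFin β).symm
  rw [← e.prod_comp, prod_tsum_eq_tsum_prod_fin, ← (e.arrowCongr (Equiv.refl ℕ)).tsum_eq]
  refine tsum_congr fun I => ?_
  rw [← e.prod_comp]
  simp

theorem distinctSum_le_one {w : ℕ → ℝ≥0∞} (hw : ∑' j, w j ≤ 1) {n : β → ℕ}
    (hn : ∀ b, n b ≠ 0) : distinctSum w n ≤ 1 := by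
  calc distinctSum w n ≤ ∑' I : β → ℕ, ∏ b, w (I b) ^ n b :=
        ENNReal.tsum_comp_le_tsum_of_injective DFunLike.coe_injective
          fun I : β → ℕ => ∏ b, w (I b) ^ n b
    _ = ∏ b, ∑' j, w j ^ n b := (prod_tsum_eq_tsum_prod fun b j => w j ^ n b).symm
    _ ≤ 1 := by
        refine Finset.prod_le_one' fun b _ => (ENNReal.tsum_le_tsum fun j => ?_).trans hw
        exact pow_le_of_le_one zero_le ((ENNReal.le_tsum j).trans hw) (hn b)

end DistinctSum

section EPPF

variable {β : Type*} [Fintype β] {α θ : ℝ}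

/-- The factor `V_{n,k} = ∏_{1 ≤ i < k} (θ + i α) / (θ + 1)_(n - 1)` of the probability of a
partition of `n` points into `k` blocks that does not depend on the sizes of the blocks, with value
`1` at `n = k = 0`; the common factor `θ` of the usual expression is cancelled. -/
noncomputable def gibbsWeight (α θ : ℝ) (n k : ℕ) : ℝ :=
  (∏ i ∈ Finset.range (k - 1), (θ + (i + 1) * α)) / rising (θ + 1) (n - 1)

/-- The exchangeable partition probability function of the Pitman–Yor process, as a function of the
sizes `n` of the blocks. -/
noncomputable def eppf (α θ : ℝ) (n : β → ℕ) : ℝ :=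
  gibbsWeight α θ (∑ b, n b) (Fintype.card β) * ∏ b, rising (1 - α) (n b - 1)

theorem gibbsWeight_nonneg (h : IsPitmanYorParam α θ) (n k : ℕ) : 0 ≤ gibbsWeight α θ n k :=
  div_nonneg (Finset.prod_nonneg fun i _ => (h.add_mul_pos i).le) (rising_pos h.add_one_pos _).le

theorem prod_rising_pos {a : ℝ} (ha : 0 < a) (n : β → ℕ) : 0 < ∏ b, rising a (n b) :=
  Finset.prod_pos fun b _ => rising_pos ha (n b)

theorem eppf_nonneg (h : IsPitmanYorParam α θ) (n : β → ℕ) : 0 ≤ eppf α θ n :=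
  mul_nonneg (gibbsWeight_nonneg h _ _) (prod_rising_pos h.one_sub_pos fun b => n b - 1).le

theorem eppf_of_isEmpty [IsEmpty β] (α θ : ℝ) (n : β → ℕ) : eppf α θ n = 1 := by
  simp [eppf, gibbsWeight]

theorem sum_eq_zero_iff_card_eq_zero {n : β → ℕ} (hn : ∀ b, n b ≠ 0) :
    ∑ b, n b = 0 ↔ Fintype.card β = 0 := by
  simp [Fintype.card_eq_zero_iff, isEmpty_iff, hn]

theorem prod_range_succ_stick (α θ : ℝ) (k : ℕ) :
    ∏ i ∈ Finset.range (k + 1), (θ + (i + 1) * α) =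
      (θ + α) * ∏ i ∈ Finset.range k, (θ + α + (i + 1) * α) := by
  rw [Finset.prod_range_succ', mul_comm]
  congr 1
  · simp
  · refine Finset.prod_congr rfl fun i _ => ?_
    push_cast
    ring

theorem rising_mul_gibbsWeight (h : IsPitmanYorParam α θ) {n k : ℕ} (hnk : n = 0 ↔ k = 0) :
    rising (θ + α) n * gibbsWeight α (θ + α) n k =
      ∏ i ∈ Finset.range k, (θ + (i + 1) * α) := by
  rcases k with _ | k
  · simp [hnk.2 rfl, gibbsWeight]
  · obtain ⟨n, rfl⟩ := Nat.exists_eq_succ_of_ne_zero (mt hnk.1 k.succ_ne_zero)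
    have := (rising_pos h.add_self.add_one_pos n).ne'
    rw [gibbsWeight, Nat.succ_eq_add_one, rising_succ_left, prod_range_succ_stick]
    simp only [Nat.add_sub_cancel]
    field_simp

theorem gibbsWeight_mul_rising (h : IsPitmanYorParam α θ) {n : ℕ} (hn : n ≠ 0) (k : ℕ) :
    gibbsWeight α θ n k * rising (θ + 1) n =
      (∏ i ∈ Finset.range (k - 1), (θ + (i + 1) * α)) * (θ + n) := by
  rw [gibbsWeight, rising_eq_rising_pred_mul hn, ← mul_assoc,
    div_mul_cancel₀ _ (rising_pos h.add_one_pos _).ne']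
  ring

theorem rising_mul_eppf (h : IsPitmanYorParam α θ) {n : β → ℕ} (hn : ∀ b, n b ≠ 0) :
    rising (θ + α) (∑ b, n b) * eppf α (θ + α) n =
      (∏ i ∈ Finset.range (Fintype.card β), (θ + (i + 1) * α)) *
        ∏ b, rising (1 - α) (n b - 1) := by
  rw [eppf, ← mul_assoc, rising_mul_gibbsWeight h (sum_eq_zero_iff_card_eq_zero hn)]

theorem rising_mul_rising_mul_eppf_ne [DecidableEq β] (h : IsPitmanYorParam α θ) {n : β → ℕ}
    (hn : ∀ b, n b ≠ 0) (b : β) :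
    rising (1 - α) (n b) * rising (θ + α) (∑ x : {x // x ≠ b}, n x) *
        eppf α (θ + α) (fun x : {x // x ≠ b} => n x) =
      (∏ i ∈ Finset.range (Fintype.card β - 1), (θ + (i + 1) * α)) *
        (∏ b, rising (1 - α) (n b - 1)) * (n b - α) := by
  have hcard : Fintype.card {x // x ≠ b} = Fintype.card β - 1 := by
    rw [Fintype.card_subtype_compl, Fintype.card_subtype_eq]
  rw [mul_assoc, rising_mul_eppf h (n := fun x : {x // x ≠ b} => n x) fun x => hn x, hcard,
    rising_eq_rising_pred_mul (hn b),
    Fintype.prod_eq_mul_prod_subtype_ne (fun b => rising (1 - α) (n b - 1)) b]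
  ring

theorem eppf_eq_shift_add [DecidableEq β] [Nonempty β] (h : IsPitmanYorParam α θ) {n : β → ℕ}
    (hn : ∀ b, n b ≠ 0) :
    eppf α θ n =
      rising (θ + α) (∑ b, n b) / rising (θ + 1) (∑ b, n b) * eppf α (θ + α) n +
        ∑ b, rising (1 - α) (n b) * rising (θ + α) (∑ x : {x // x ≠ b}, n x) /
          rising (θ + 1) (∑ b, n b) * eppf α (θ + α) fun x : {x // x ≠ b} => n x := by
  set N := ∑ b, n b with hN
  obtain ⟨k, hk⟩ := Nat.exists_eq_succ_of_ne_zero (Fintype.card_ne_zero (α := β))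
  have hN0 : N ≠ 0 := mt (sum_eq_zero_iff_card_eq_zero hn).1 Fintype.card_ne_zero
  have hpos := (rising_pos h.add_one_pos N).ne'
  have hsizes : ∑ b, ((n b : ℝ) - α) = N - (k + 1) * α := by
    rw [Finset.sum_sub_distrib, ← Nat.cast_sum, Finset.sum_const, Finset.card_univ, hk]
    simp [hN]
  simp_rw [div_mul_eq_mul_div, ← Finset.sum_div, ← add_div,
    rising_mul_rising_mul_eppf_ne h hn, ← Finset.mul_sum, hsizes]
  rw [rising_mul_eppf h hn, eq_div_iff hpos, eppf, mul_right_comm, gibbsWeight_mul_rising h hN0,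
    hk, Nat.succ_eq_add_one, Finset.prod_range_succ, Nat.add_sub_cancel]
  ring

theorem prod_stick_le_rising (h : IsPitmanYorParam α θ) (k : ℕ) :
    ∏ i ∈ Finset.range k, (θ + (i + 1) * α) ≤ rising (θ + 1) k :=
  Finset.prod_le_prod (fun i _ => (h.add_mul_pos i).le) fun i _ => by
    nlinarith [mul_nonneg (Nat.cast_nonneg (α := ℝ) i) h.one_sub_pos.le, h.lt_one]

theorem gibbsWeight_le {θ' : ℝ} (h : IsPitmanYorParam α θ) (hθ : θ ≤ θ') {n k : ℕ} (hk : k ≠ 0)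
    (hkn : k ≤ n) : gibbsWeight α θ' n k ≤ 1 / rising (θ + 1) (n - k) := by
  have h' := h.mono hθ
  have hsplit : n - 1 = (k - 1) + (n - k) := by omega
  have hden : rising (θ + 1) (n - k) ≤ rising (θ' + 1 + (k - 1 : ℕ)) (n - k) :=
    rising_mono h.add_one_pos.le (by linarith [Nat.cast_nonneg (α := ℝ) (k - 1)]) _
  have hpos := rising_pos h'.add_one_pos (k - 1)
  calc gibbsWeight α θ' n k
      ≤ rising (θ' + 1) (k - 1) / (rising (θ' + 1) (k - 1) * rising (θ + 1) (n - k)) := by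
        rw [gibbsWeight, hsplit, rising_add]
        exact div_le_div₀ hpos.le (prod_stick_le_rising h' _)
          (mul_pos hpos (rising_pos h.add_one_pos _)) (mul_le_mul_of_nonneg_left hden hpos.le)
    _ = 1 / rising (θ + 1) (n - k) := by rw [div_mul_eq_div_div, div_self hpos.ne']

theorem exists_eppf_le [Nonempty β] (h : IsPitmanYorParam α θ) {n : β → ℕ} (hn : ∀ b, n b ≠ 0) :
    ∃ M, ∀ θ', θ ≤ θ' → eppf α θ' n ≤ M := by
  have hcard : Fintype.card β ≤ ∑ b, n b :=
    (Fintype.card_eq_sum_ones (α := β)).trans_le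
      (Finset.sum_le_sum fun b _ => Nat.one_le_iff_ne_zero.2 (hn b))
  exact ⟨_, fun θ' hθ => mul_le_mul_of_nonneg_right (gibbsWeight_le h hθ Fintype.card_ne_zero hcard)
    (prod_rising_pos h.one_sub_pos fun b => n b - 1).le⟩

end EPPF

/-- The divergence of the harmonic series forces the product of the factors `a r` to vanish. -/
theorem eq_zero_of_contracting_recursion {f a : ℕ → ℝ} {c M : ℝ} (hc : 0 < c)
    (hf : ∀ r, f r = a r * f (r + 1)) (ha0 : ∀ r, 0 ≤ a r)
    (ha : ∀ r : ℕ, a r ≤ 1 - c * (1 / (r + 1))) (hM : ∀ r, |f r| ≤ M) : f 0 = 0 := by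
  let S : ℕ → ℝ := fun N => ∑ i ∈ Finset.range N, 1 / ((i : ℝ) + 1)
  have hexp : ∀ r, a r ≤ Real.exp (-c * (1 / ((r : ℝ) + 1))) := fun r => by
    linarith [ha r, Real.add_one_le_exp (-c * (1 / ((r : ℝ) + 1)))]
  have hbound : ∀ N, |f 0| ≤ Real.exp (-c * S N) * |f N| := by
    intro N
    induction N with
    | zero => simp [S]
    | succ N ih =>
      rw [hf N, abs_mul, abs_of_nonneg (ha0 N)] at ih
      simp_rw [S, Finset.sum_range_succ, mul_add, Real.exp_add, mul_assoc]
      exact ih.trans (by gcongr; exact hexp N)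
  have hlim : Filter.Tendsto (fun N => Real.exp (-c * S N) * M) Filter.atTop (nhds 0) := by
    rw [← zero_mul M]
    refine (Real.tendsto_exp_atBot.comp ?_).mul_const M
    exact Real.tendsto_sum_range_one_div_nat_succ_atTop.const_mul_atTop_of_neg (by linarith)
  refine abs_eq_zero.1 (le_antisymm (ge_of_tendsto' hlim fun N => (hbound N).trans ?_)
    (abs_nonneg _))
  gcongr
  exact hM N

section ShiftRecursion

variable {α θ : ℝ}

theorem rising_div_rising_nonneg (h : IsPitmanYorParam α θ) (N : ℕ) :
    0 ≤ rising (θ + α) N / rising (θ + 1) N :=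
  div_nonneg (rising_pos h.add_self_pos N).le (rising_pos h.add_one_pos N).le

theorem rising_div_rising_le (h : IsPitmanYorParam α θ) {N : ℕ} (hN : N ≠ 0) :
    rising (θ + α) N / rising (θ + 1) N ≤ 1 - (1 - α) / (θ + 1) := by
  obtain ⟨k, rfl⟩ := Nat.exists_eq_succ_of_ne_zero hN
  have h1 := h.add_one_pos
  have hle : rising (θ + α + 1) k ≤ rising (θ + 1 + 1) k :=
    rising_mono (by linarith [h.add_self_pos]) (by linarith [h.lt_one]) k
  calc rising (θ + α) (k + 1) / rising (θ + 1) (k + 1)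
      = (θ + α) / (θ + 1) * (rising (θ + α + 1) k / rising (θ + 1 + 1) k) := by
        rw [rising_succ_left, rising_succ_left, mul_div_mul_comm]
    _ ≤ (θ + α) / (θ + 1) * 1 := by
        gcongr
        · exact div_nonneg h.add_self_pos.le h1.le
        · exact div_le_one_of_le₀ hle (rising_pos (by linarith) k).le
    _ = 1 - (1 - α) / (θ + 1) := by
        field_simp
        ring

theorem eq_zero_of_shift_recursion (h : IsPitmanYorParam α θ) {N : ℕ} (hN : N ≠ 0) {D : ℝ → ℝ}
    {M : ℝ} (hrec : ∀ t, θ ≤ t → D t = rising (t + α) N / rising (t + 1) N * D (t + α))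
    (hM : ∀ t, θ ≤ t → |D t| ≤ M) : D θ = 0 := by
  have hle : ∀ r : ℕ, θ ≤ θ + r * α := fun r =>
    le_add_of_nonneg_right (mul_nonneg r.cast_nonneg h.nonneg)
  have hpos : 0 < θ + 2 := by linarith [h.add_one_pos]
  have hzero := eq_zero_of_contracting_recursion (f := fun r : ℕ => D (θ + r * α))
    (div_pos h.one_sub_pos hpos) (fun r => ?_)
    (fun r => rising_div_rising_nonneg (h.mono (hle r)) N) (fun r => ?_) fun r => hM _ (hle r)
  · simpa using hzero
  · rw [hrec _ (hle r)]
    push_cast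
    ring_nf
  · have hden : θ + r * α + 1 ≤ (θ + 2) * (r + 1) := by
      have hpos : 0 ≤ θ + 2 - α := by linarith [h.lt_one, h.neg_lt]
      nlinarith [mul_nonneg r.cast_nonneg hpos]
    refine (rising_div_rising_le (h.mono (hle r)) hN).trans (sub_le_sub_left ?_ 1)
    rw [div_mul_div_comm, mul_one]
    exact div_le_div_of_nonneg_left h.one_sub_pos.le (h.mono (hle r)).add_one_pos hden

end ShiftRecursion

section DistinctSumIntegral

variable {β : Type*} [Fintype β] {α θ : ℝ}

theorem lintegral_distinctSum_le_one (h : IsPitmanYorParam α θ) {n : β → ℕ} (hn : ∀ b, n b ≠ 0) :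
    ∫⁻ v, distinctSum (stickWeight v) n ∂stickLaw α θ ≤ 1 := by
  have := h.isProbabilityMeasure_stickLaw
  calc ∫⁻ v, distinctSum (stickWeight v) n ∂stickLaw α θ ≤ ∫⁻ _, 1 ∂stickLaw α θ := by
        refine lintegral_mono_ae ?_
        filter_upwards [ae_stickLaw_mem_Ioo h] with v hv
        exact distinctSum_le_one (tsum_stickWeight_le_one hv) hn
    _ = 1 := by simp

theorem distinctSum_stickWeight [DecidableEq β] {v : ℕ → ℝ} (hv : v 0 ≤ 1) (n : β → ℕ) :
    distinctSum (stickWeight v) n =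
      ENNReal.ofReal (v 0) ^ 0 * ENNReal.ofReal (1 - v 0) ^ (∑ b, n b) *
          distinctSum (stickWeight fun i => v (i + 1)) n +
        ∑ b, ENNReal.ofReal (v 0) ^ n b * ENNReal.ofReal (1 - v 0) ^ (∑ x : {x // x ≠ b}, n x) *
          distinctSum (stickWeight fun i => v (i + 1)) fun x : {x // x ≠ b} => n x := by
  simp_rw [distinctSum_eq_shift_add (stickWeight v), stickWeight_succ hv, stickWeight_zero,
    distinctSum_const_mul, pow_zero, one_mul, mul_assoc]

theorem lintegral_distinctSum_eq_shift_add [DecidableEq β] (h : IsPitmanYorParam α θ)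
    (n : β → ℕ) :
    ∫⁻ v, distinctSum (stickWeight v) n ∂stickLaw α θ =
      ENNReal.ofReal (rising (θ + α) (∑ b, n b) / rising (θ + 1) (∑ b, n b)) *
          ∫⁻ v, distinctSum (stickWeight v) n ∂stickLaw α (θ + α) +
        ∑ b, ENNReal.ofReal (rising (1 - α) (n b) * rising (θ + α) (∑ x : {x // x ≠ b}, n x) /
            rising (θ + 1) (∑ b, n b)) *
          ∫⁻ v, distinctSum (stickWeight v) (fun x : {x // x ≠ b} => n x)
            ∂stickLaw α (θ + α) := by
  have hmeas := measurable_distinctSum measurable_stickWeight n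
  have hmeas' (b : β) : Measurable fun v =>
      distinctSum (stickWeight v) fun x : {x // x ≠ b} => n x :=
    measurable_distinctSum measurable_stickWeight fun x : {x // x ≠ b} => n x
  have htail : Measurable fun (v : ℕ → ℝ) i => v (i + 1) := by fun_prop
  have hcongr := (ae_stickLaw_mem_Ioo h).mono fun v hv => distinctSum_stickWeight (hv 0).2.le n
  rw [lintegral_congr_ae hcongr, lintegral_add_left (by have := hmeas.comp htail; fun_prop),
    lintegral_finsetSum _ fun b _ => by have := (hmeas' b).comp htail; fun_prop]
  simp_rw [lintegral_stickLaw_head_tail h _ _ hmeas, lintegral_stickLaw_head_tail h _ _ (hmeas' _),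
    ← Fintype.sum_eq_add_sum_subtype_ne n, rising_zero, zero_add, one_mul]

theorem eppf_sub_lintegral_distinctSum [DecidableEq β] [Nonempty β] (h : IsPitmanYorParam α θ)
    {n : β → ℕ} (hn : ∀ b, n b ≠ 0)
    (hne : ∀ b : β, ∫⁻ v, distinctSum (stickWeight v) (fun x : {x // x ≠ b} => n x)
      ∂stickLaw α (θ + α) = ENNReal.ofReal (eppf α (θ + α) fun x : {x // x ≠ b} => n x)) :
    eppf α θ n - (∫⁻ v, distinctSum (stickWeight v) n ∂stickLaw α θ).toReal =
      rising (θ + α) (∑ b, n b) / rising (θ + 1) (∑ b, n b) *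
        (eppf α (θ + α) n -
          (∫⁻ v, distinctSum (stickWeight v) n ∂stickLaw α (θ + α)).toReal) := by
  have hfin := ne_top_of_le_ne_top ENNReal.one_ne_top (lintegral_distinctSum_le_one h.add_self hn)
  have hcoeff : ∀ b, 0 ≤ rising (1 - α) (n b) * rising (θ + α) (∑ x : {x // x ≠ b}, n x) /
      rising (θ + 1) (∑ b, n b) := fun b =>
    div_nonneg (mul_pos (rising_pos h.one_sub_pos _) (rising_pos h.add_self_pos _)).le
      (rising_pos h.add_one_pos _).le
  rw [lintegral_distinctSum_eq_shift_add h, eppf_eq_shift_add h hn,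
    ENNReal.toReal_add (ENNReal.mul_ne_top ENNReal.ofReal_ne_top hfin)
      (by simp [hne, ENNReal.mul_eq_top]), ENNReal.toReal_mul,
    ENNReal.toReal_ofReal (rising_div_rising_nonneg h _),
    ENNReal.toReal_sum fun b _ => by simp [hne, ENNReal.mul_eq_top]]
  simp_rw [hne, ENNReal.toReal_mul, ENNReal.toReal_ofReal (hcoeff _),
    ENNReal.toReal_ofReal (eppf_nonneg h.add_self _)]
  ring

theorem lintegral_distinctSum (h : IsPitmanYorParam α θ) {n : β → ℕ} (hn : ∀ b, n b ≠ 0) :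
    ∫⁻ v, distinctSum (stickWeight v) n ∂stickLaw α θ = ENNReal.ofReal (eppf α θ n) := by
  classical
  induction hk : Fintype.card β generalizing β θ with
  | zero =>
    have := h.isProbabilityMeasure_stickLaw
    have := Fintype.card_eq_zero_iff.1 hk
    simp [distinctSum_of_isEmpty, eppf_of_isEmpty]
  | succ k ih =>
    have : Nonempty β := Fintype.card_pos_iff.1 (hk ▸ k.succ_pos)
    have hN : ∑ b, n b ≠ 0 := mt (sum_eq_zero_iff_card_eq_zero hn).1 Fintype.card_ne_zero
    have hfin := ne_top_of_le_ne_top ENNReal.one_ne_top (lintegral_distinctSum_le_one h hn)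
    have hcard : ∀ b : β, Fintype.card {x // x ≠ b} = k := fun b => by
      rw [Fintype.card_subtype_compl, Fintype.card_subtype_eq, hk, Nat.add_sub_cancel]
    obtain ⟨M, hM⟩ := exists_eppf_le h hn
    have hzero := eq_zero_of_shift_recursion h hN (M := M + 1)
      (D := fun t => eppf α t n - (∫⁻ v, distinctSum (stickWeight v) n ∂stickLaw α t).toReal)
      (fun t ht => eppf_sub_lintegral_distinctSum (h.mono ht) hn fun b =>
        ih (h.mono ht).add_self (fun x => hn x) (hcard b)) fun t ht => ?_
    · rw [sub_eq_zero.1 hzero, ENNReal.ofReal_toReal hfin]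
    · have hnonneg : 0 ≤ (∫⁻ v, distinctSum (stickWeight v) n ∂stickLaw α t).toReal :=
        ENNReal.toReal_nonneg
      have hle : (∫⁻ v, distinctSum (stickWeight v) n ∂stickLaw α t).toReal ≤ 1 :=
        ENNReal.toReal_mono ENNReal.one_ne_top (lintegral_distinctSum_le_one (h.mono ht) hn)
      have hnonneg' := eppf_nonneg (h.mono ht) n
      have hM' := hM t ht
      exact abs_le.2 ⟨by linarith, by linarith⟩

end DistinctSumIntegral

section SetPartitions

variable {ι κ β : Type*} {α θ : ℝ}

instance finite_setoid [Finite ι] : Finite (Setoid ι) :=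
  Finite.of_injective (fun (s : Setoid ι) x y => s x y) fun _ _ h =>
    Setoid.ext fun x y => iff_of_eq (congr_fun₂ h x y)

noncomputable instance fintypeSetoid [Finite ι] : Fintype (Setoid ι) := Fintype.ofFinite _

noncomputable instance fintypeQuotient [Finite ι] (s : Setoid ι) : Fintype (Quotient s) :=
  Fintype.ofFinite _

/-- The number of blocks of a set partition, set partitions being encoded as equivalence
relations. -/
noncomputable def numBlocks (s : Setoid ι) : ℕ := Nat.card (Quotient s)

/-- The size of a block of a set partition. -/
noncomputable def blockCard (s : Setoid ι) (q : Quotient s) : ℕ :=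
  Nat.card {i // (⟦i⟧ : Quotient s) = q}

/-- The factor `∏_B (1 - α)_(|B| - 1)` of the probability of a set partition that depends on the
sizes of its blocks `B`. -/
noncomputable def blockProd [Finite ι] (α : ℝ) (s : Setoid ι) : ℝ :=
  ∏ q, rising (1 - α) (blockCard s q - 1)

/-- The probability that a sample from the Pitman–Yor process generates the set partition `s`. -/
noncomputable def partitionProb [Finite ι] (α θ : ℝ) (s : Setoid ι) : ℝ := eppf α θ (blockCard s)

theorem numBlocks_eq_card [Finite ι] (s : Setoid ι) : numBlocks s = Fintype.card (Quotient s) :=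
  Nat.card_eq_fintype_card

theorem numBlocks_ker (g : ι → β) : numBlocks (Setoid.ker g) = (Set.range g).ncard :=
  Nat.card_congr (Setoid.quotientKerEquivRange g)

theorem numBlocks_ker_of_surjective {g : ι → β} (hg : Function.Surjective g) :
    numBlocks (Setoid.ker g) = Nat.card β :=
  Nat.card_congr (Setoid.quotientKerEquivOfSurjective g hg)

theorem numBlocks_comap_equiv (e : κ ≃ ι) (s : Setoid ι) : numBlocks (s.comap e) = numBlocks s := by
  rw [Setoid.comap_eq]
  exact numBlocks_ker_of_surjective (Quotient.mk''_surjective.comp e.surjective)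

theorem sum_setoid_comap_equiv [Finite ι] [Finite κ] {M : Type*} [AddCommMonoid M] (e : κ ≃ ι)
    (Φ : Setoid κ → M) : ∑ s : Setoid ι, Φ (s.comap e) = ∑ s, Φ s := by
  refine Fintype.sum_bijective (Setoid.comap e) ⟨Setoid.comap_injective e e.surjective,
    Setoid.comap_surjective e e.injective⟩ _ _ fun _ => rfl

variable [Finite ι] [Finite κ]

theorem numBlocks_le_card (s : Setoid ι) : numBlocks s ≤ Nat.card ι :=
  Nat.card_le_card_of_surjective _ Quotient.mk_surjective

theorem numBlocks_eq_zero_iff (s : Setoid ι) : numBlocks s = 0 ↔ Nat.card ι = 0 := by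
  rw [numBlocks, Finite.card_eq_zero_iff, Finite.card_eq_zero_iff,
    ← not_nonempty_iff, ← not_nonempty_iff, nonempty_quotient_iff]

theorem blockCard_ne_zero (s : Setoid ι) (q : Quotient s) : blockCard s q ≠ 0 :=
  have : Nonempty {i // (⟦i⟧ : Quotient s) = q} := ⟨q.out, q.out_eq⟩
  Nat.card_pos.ne'

theorem sum_blockCard (s : Setoid ι) : ∑ q, blockCard s q = Nat.card ι := by
  rw [← Nat.card_congr (Equiv.sigmaFiberEquiv (Quotient.mk s)), Nat.card_sigma]
  rfl

theorem partitionProb_eq (α θ : ℝ) (s : Setoid ι) :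
    partitionProb α θ s = gibbsWeight α θ (Nat.card ι) (numBlocks s) * blockProd α s := by
  rw [partitionProb, eppf, sum_blockCard, numBlocks_eq_card, blockProd]

theorem partitionProb_nonneg (h : IsPitmanYorParam α θ) (s : Setoid ι) : 0 ≤ partitionProb α θ s :=
  eppf_nonneg h _

theorem blockProd_ker [Fintype β] (α : ℝ) {g : ι → β} (hg : Function.Surjective g) :
    blockProd α (Setoid.ker g) = ∏ b, rising (1 - α) (Nat.card {i // g i = b} - 1) := by
  refine Fintype.prod_equiv (Setoid.quotientKerEquivOfSurjective g hg) _ _ fun q => ?_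
  obtain ⟨i, rfl⟩ := Quotient.mk_surjective q
  congr 2
  exact Nat.card_congr (Equiv.subtypeEquivRight fun _ => Quotient.eq)

theorem blockProd_comap_equiv (α : ℝ) (e : κ ≃ ι) (s : Setoid ι) :
    blockProd α (s.comap e) = blockProd α s := by
  rw [Setoid.comap_eq, blockProd_ker α (Quotient.mk''_surjective.comp e.surjective)]
  refine Finset.prod_congr rfl fun q _ => ?_
  congr 2
  exact Nat.card_congr (e.subtypeEquiv fun i => Iff.rfl)

theorem partitionProb_comap_equiv (α θ : ℝ) (e : κ ≃ ι) (s : Setoid ι) :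
    partitionProb α θ (s.comap e) = partitionProb α θ s := by
  rw [partitionProb_eq, partitionProb_eq, numBlocks_comap_equiv, blockProd_comap_equiv,
    Nat.card_congr e]

end SetPartitions

section AddPoint

variable {ι : Type*}

/-- The partition of `Option ι` obtained from a partition of `ι` by adding the point `none` to the
block `o`, or as a new block if `o` is `none`. -/
def extendSetoid (s : Setoid ι) (o : Option (Quotient s)) : Setoid (Option ι) :=
  Setoid.ker fun x : Option ι => x.elim o fun i => some ⟦i⟧

theorem extendSetoid_none_some (s : Setoid ι) (o : Option (Quotient s)) (i : ι) :
    extendSetoid s o none (some i) ↔ o = some ⟦i⟧ := Iff.rfl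

theorem comap_extendSetoid (s : Setoid ι) (o : Option (Quotient s)) :
    (extendSetoid s o).comap some = s :=
  Setoid.ext fun _ _ => Option.some_inj.trans Quotient.eq

theorem extendSetoid_some (s : Setoid ι) (q : Quotient s) :
    extendSetoid s (some q) = Setoid.ker fun x : Option ι => x.elim q (Quotient.mk s) := by
  refine Setoid.ext fun x y => ?_
  rcases x with _ | x <;> rcases y with _ | y <;> exact Option.some_inj

theorem setoid_option_ext {t t' : Setoid (Option ι)} (h : t.comap some = t'.comap some)
    (h' : ∀ i, t none (some i) ↔ t' none (some i)) : t = t' := by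
  refine Setoid.ext fun x y => ?_
  rcases x with _ | x <;> rcases y with _ | y
  · exact iff_of_true (t.refl' _) (t'.refl' _)
  · exact h' y
  · exact t.comm'.trans ((h' x).trans t'.comm')
  · exact Setoid.ext_iff.1 h x y

theorem extendSetoid_injective :
    Function.Injective fun p : Σ s : Setoid ι, Option (Quotient s) => extendSetoid p.1 p.2 := by
  rintro ⟨s, o⟩ ⟨s', o'⟩ heq
  obtain rfl : s = s' := by
    rw [← comap_extendSetoid s o, ← comap_extendSetoid s' o']
    exact congr_arg _ heq
  have hnone (i : ι) : o = some ⟦i⟧ ↔ o' = some ⟦i⟧ := Setoid.ext_iff.1 heq none (some i)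
  congr 1
  refine Option.ext fun q => ?_
  obtain ⟨i, rfl⟩ := Quotient.mk_surjective q
  exact hnone i

theorem extendSetoid_surjective :
    Function.Surjective fun p : Σ s : Setoid ι, Option (Quotient s) => extendSetoid p.1 p.2 := by
  intro t
  by_cases h : ∃ i, t none (some i)
  · obtain ⟨i, hi⟩ := h
    refine ⟨⟨t.comap some, some ⟦i⟧⟩, setoid_option_ext (comap_extendSetoid _ _) fun j => ?_⟩
    rw [extendSetoid_none_some, Option.some_inj, Quotient.eq]
    exact ⟨t.trans' hi, t.trans' (t.symm' hi)⟩
  · push Not at h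
    refine ⟨⟨t.comap some, none⟩, setoid_option_ext (comap_extendSetoid _ _) fun j => ?_⟩
    simpa [extendSetoid_none_some] using h j

theorem surjective_elim_some (s : Setoid ι) (q : Quotient s) :
    Function.Surjective fun x : Option ι => x.elim q (Quotient.mk s) := fun q' =>
  ⟨some q'.out, q'.out_eq⟩

theorem surjective_elim_none (s : Setoid ι) :
    Function.Surjective fun x : Option ι => x.elim none fun i => some (⟦i⟧ : Quotient s) := by
  rintro (_ | q)
  exacts [⟨none, rfl⟩, ⟨some q.out, congr_arg some q.out_eq⟩]

theorem numBlocks_extendSetoid_some (s : Setoid ι) (q : Quotient s) :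
    numBlocks (extendSetoid s (some q)) = numBlocks s := by
  rw [extendSetoid_some, numBlocks_ker_of_surjective (surjective_elim_some s q), numBlocks]

variable [Finite ι]

theorem numBlocks_extendSetoid_none (s : Setoid ι) :
    numBlocks (extendSetoid s none) = numBlocks s + 1 := by
  rw [extendSetoid, numBlocks_ker_of_surjective (surjective_elim_none s), Finite.card_option,
    numBlocks]

theorem card_fiber_elim {β : Type*} [DecidableEq β] (o : β) (g : ι → β) (b : β) :
    Nat.card {x : Option ι // x.elim o g = b} =
      (if o = b then 1 else 0) + Nat.card {i // g i = b} := by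
  have := Fintype.ofFinite ι
  simp only [Nat.card_eq_fintype_card, Fintype.card_subtype, Finset.card_filter,
    Fintype.sum_option, Option.elim]

theorem blockProd_extendSetoid_none (α : ℝ) (s : Setoid ι) :
    blockProd α (extendSetoid s none) = blockProd α s := by
  classical
  rw [extendSetoid, blockProd_ker α (surjective_elim_none s), Fintype.prod_option]
  simp [card_fiber_elim, blockProd, blockCard, rising_zero]

theorem blockProd_extendSetoid_some (α : ℝ) (s : Setoid ι) (q : Quotient s) :
    blockProd α (extendSetoid s (some q)) = (blockCard s q - α) * blockProd α s := by
  classical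
  rw [extendSetoid_some, blockProd_ker α (surjective_elim_some s q), blockProd,
    Fintype.prod_eq_mul_prod_subtype_ne _ q, Fintype.prod_eq_mul_prod_subtype_ne _ q, ← mul_assoc]
  congr 1
  · have h := rising_eq_rising_pred_mul (blockCard_ne_zero s q) (1 - α)
    rw [card_fiber_elim, if_pos rfl, Nat.add_sub_cancel_left]
    change rising (1 - α) (blockCard s q) = _
    linear_combination h
  · refine Finset.prod_congr rfl fun q' _ => ?_
    rw [card_fiber_elim, if_neg q'.2.symm, zero_add, blockCard]

theorem sum_setoid_option (α : ℝ) (ψ : Setoid ι → ℕ → ℝ) :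
    ∑ t : Setoid (Option ι), ψ (t.comap some) (numBlocks t) * blockProd α t =
      ∑ s : Setoid ι, (ψ s (numBlocks s + 1) + (Nat.card ι - numBlocks s * α) * ψ s (numBlocks s)) *
        blockProd α s := by
  rw [← Fintype.sum_bijective _ ⟨extendSetoid_injective, extendSetoid_surjective⟩ _ _ fun _ => rfl,
    Fintype.sum_sigma]
  refine Finset.sum_congr rfl fun s _ => ?_
  have hcard : ∑ q, ((blockCard s q : ℝ) - α) = Nat.card ι - numBlocks s * α := by
    rw [Finset.sum_sub_distrib, ← Nat.cast_sum, sum_blockCard, Finset.sum_const, Finset.card_univ,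
      nsmul_eq_mul, numBlocks_eq_card]
  simp only [Fintype.sum_option, comap_extendSetoid, numBlocks_extendSetoid_none,
    numBlocks_extendSetoid_some, blockProd_extendSetoid_none, blockProd_extendSetoid_some]
  rw [← Finset.mul_sum, ← Finset.sum_mul, hcard]
  ring

end AddPoint

section DistinctValues

variable {α θ : ℝ}

/-- The generalized Stirling number `S(n, k; α) = 𝒞(n, k; α) / α ^ k`: the sum over the partitions
of `n` points into `k` blocks `B` of `∏_B (1 - α)_(|B| - 1)`. -/
noncomputable def genStirling (α : ℝ) : ℕ → ℕ → ℝ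
  | 0, 0 => 1
  | 0, _ + 1 => 0
  | _ + 1, 0 => 0
  | n + 1, k + 1 => genStirling α n k + (n - (k + 1) * α) * genStirling α n (k + 1)

theorem genStirling_zero_eq_stirlingFirst (n k : ℕ) : genStirling 0 n k = n.stirlingFirst k := by
  induction n generalizing k with
  | zero => cases k <;> simp [genStirling]
  | succ n ih =>
    cases k with
    | zero => simp [genStirling]
    | succ k =>
      rw [genStirling, ih, ih, Nat.stirlingFirst_succ_succ]
      push_cast
      ring

theorem sum_blockProd_of_numBlocks_fin (α : ℝ) (n k : ℕ) :
    ∑ s : Setoid (Fin n) with numBlocks s = k, blockProd α s = genStirling α n k := by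
  simp only [Finset.sum_filter]
  induction n generalizing k with
  | zero =>
    have : Unique (Setoid (Fin 0)) := ⟨⟨⊤⟩, fun s => Setoid.ext fun x => x.elim0⟩
    cases k <;> rw [Fintype.sum_unique] <;> simp [genStirling, blockProd, numBlocks]
  | succ n ih =>
    rcases k with _ | k
    · simp [genStirling, numBlocks_eq_zero_iff]
    have h := sum_setoid_option α fun (_ : Setoid (Fin n)) j => if j = k + 1 then (1 : ℝ) else 0
    rw [← sum_setoid_comap_equiv (finSuccEquiv n) fun s =>
      if numBlocks s = k + 1 then blockProd α s else 0]
    simp only [ite_mul, one_mul, zero_mul, numBlocks_comap_equiv, blockProd_comap_equiv,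
      Nat.card_eq_fintype_card (α := Fin n), Fintype.card_fin] at h ⊢
    rw [h, genStirling, ← ih, ← ih, Finset.mul_sum, ← Finset.sum_add_distrib]
    refine Finset.sum_congr rfl fun s _ => ?_
    by_cases hs : numBlocks s = k
    · simp [hs]
    · by_cases hs' : numBlocks s = k + 1 <;> simp [hs, hs']

theorem sum_blockProd_of_numBlocks (α : ℝ) (ι : Type*) [Finite ι] (k : ℕ) :
    ∑ s : Setoid ι with numBlocks s = k, blockProd α s = genStirling α (Nat.card ι) k := by
  rw [← sum_blockProd_of_numBlocks_fin, Finset.sum_filter, Finset.sum_filter,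
    ← sum_setoid_comap_equiv (Finite.equivFin ι) fun s =>
      if numBlocks s = k then blockProd α s else 0]
  simp only [numBlocks_comap_equiv, blockProd_comap_equiv]

theorem genFactCoeff_zero (k : ℕ) (α : ℝ) : genFactCoeff 0 k α = if k = 0 then 1 else 0 := by
  have h := congr_arg (Int.cast : ℤ → ℝ) (Int.alternating_sum_range_choose (n := k))
  push_cast at h
  simp only [genFactCoeff, rising_zero, mul_one, mul_comm (Nat.cast _ : ℝ), h]
  split_ifs with hk <;> simp [hk]

theorem genFactCoeff_succ_zero (n : ℕ) (α : ℝ) : genFactCoeff (n + 1) 0 α = 0 := by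
  simp [genFactCoeff, rising_succ_left]

theorem genFactCoeff_succ_succ (n k : ℕ) (α : ℝ) :
    genFactCoeff (n + 1) (k + 1) α =
      α * genFactCoeff n k α + (n - (k + 1) * α) * genFactCoeff n (k + 1) α := by
  have hterm : ∀ i ∈ Finset.range (k + 2),
      ((k + 1).choose i : ℝ) * (-1) ^ i * rising (-(i * α)) (n + 1) =
        (n - (k + 1) * α) * (((k + 1).choose i : ℝ) * (-1) ^ i * rising (-(i * α)) n) +
          α * (k + 1) * ((k.choose i : ℝ) * (-1) ^ i * rising (-(i * α)) n) := by
    intro i hi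
    have hchoose := congr_arg (Nat.cast : ℕ → ℝ) (Nat.choose_mul_succ_eq k i)
    push_cast [Nat.cast_sub (Nat.lt_succ_iff.1 (Finset.mem_range.1 hi))] at hchoose
    rw [rising_succ]
    linear_combination -(-1) ^ i * rising (-(i * α)) n * α * hchoose
  have := Nat.factorial_ne_zero k
  rw [genFactCoeff, Finset.sum_congr rfl hterm, Finset.sum_add_distrib, ← Finset.mul_sum,
    ← Finset.mul_sum, Finset.sum_range_succ (fun i => (k.choose i : ℝ) * (-1) ^ i * _),
    genFactCoeff, genFactCoeff, Nat.choose_succ_self, Nat.factorial_succ]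
  push_cast
  field_simp
  ring

theorem genFactCoeff_eq_pow_mul_genStirling (n k : ℕ) (α : ℝ) :
    genFactCoeff n k α = α ^ k * genStirling α n k := by
  induction n generalizing k with
  | zero => cases k <;> simp [genFactCoeff_zero, genStirling]
  | succ n ih =>
    cases k with
    | zero => simp [genFactCoeff_succ_zero, genStirling]
    | succ k =>
      rw [genFactCoeff_succ_succ, ih, ih, genStirling]
      ring

theorem prod_add_mul_eq_pow_mul_rising {α : ℝ} (hα : α ≠ 0) (θ : ℝ) (k : ℕ) :
    ∏ i ∈ Finset.range k, (θ + i * α) = α ^ k * rising (θ / α) k := by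
  rw [rising, show α ^ k = ∏ _i ∈ Finset.range k, α by simp, ← Finset.prod_mul_distrib]
  refine Finset.prod_congr rfl fun i _ => ?_
  field_simp

theorem prod_range_succ_add_mul (α θ : ℝ) (k : ℕ) :
    ∏ i ∈ Finset.range (k + 1), (θ + i * α) = θ * ∏ i ∈ Finset.range k, (θ + (i + 1) * α) := by
  rw [Finset.prod_range_succ']
  simp [mul_comm]

theorem distinctPMF_eq (h : IsPitmanYorParam α θ) (n k : ℕ) :
    distinctPMF α θ n k = gibbsWeight α θ n k * genStirling α n k := by
  rcases n with _ | n
  · cases k <;> simp [distinctPMF, gibbsWeight, genStirling, genFactCoeff_zero]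
  rcases k with _ | k
  · simp [distinctPMF, genStirling, genFactCoeff_succ_zero]
  have hr := (rising_pos h.add_one_pos n).ne'
  rw [gibbsWeight, Nat.add_sub_cancel, Nat.add_sub_cancel, distinctPMF]
  split_ifs with hα h₂
  · subst hα
    have hθ : θ ≠ 0 := by linarith [h.neg_lt]
    rw [genStirling_zero_eq_stirlingFirst, rising_succ_left, pow_succ']
    simp only [mul_zero, add_zero, Finset.prod_const, Finset.card_range]
    field_simp
  · obtain ⟨rfl, -⟩ := h₂
    have hshift (i : ℕ) : 0 + ((i : ℝ) + 1) * α = α + i * α := by ring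
    have hprod := prod_add_mul_eq_pow_mul_rising hα α k
    rw [div_self hα] at hprod
    rw [genFactCoeff_eq_pow_mul_genStirling, Nat.add_sub_cancel, Nat.add_sub_cancel, zero_add,
      Finset.prod_congr (rfl : Finset.range k = _) fun i _ => hshift i, hprod]
    rw [zero_add] at hr
    field_simp
    ring
  · have hθ : θ ≠ 0 := by simpa using h₂
    have hprod := prod_add_mul_eq_pow_mul_rising hα θ (k + 1)
    rw [prod_range_succ_add_mul] at hprod
    rw [genFactCoeff_eq_pow_mul_genStirling, ← mul_assoc, div_mul_eq_mul_div,
      mul_comm (rising _ _), ← hprod, rising_succ_left, mul_div_mul_left _ _ hθ]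

theorem sum_partitionProb_of_numBlocks (h : IsPitmanYorParam α θ) (ι : Type*) [Finite ι] (k : ℕ) :
    ∑ s : Setoid ι with numBlocks s = k, partitionProb α θ s = distinctPMF α θ (Nat.card ι) k := by
  rw [distinctPMF_eq h, ← sum_blockProd_of_numBlocks, Finset.mul_sum]
  refine Finset.sum_congr rfl fun s hs => ?_
  rw [partitionProb_eq, (Finset.mem_filter.1 hs).2]

theorem sum_partitionProb_mul_pow_numBlocks (h : IsPitmanYorParam α θ) (ι : Type*) [Finite ι]
    (x : ℝ) :
    ∑ s : Setoid ι, partitionProb α θ s * x ^ numBlocks s = distinctPGF (Nat.card ι) x α θ := by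
  have hmaps : ∀ s ∈ Finset.univ (α := Setoid ι), numBlocks s ∈ Finset.range (Nat.card ι + 1) :=
    fun s _ => Finset.mem_range_succ_iff.2 (numBlocks_le_card s)
  simp_rw [distinctPGF, ← sum_partitionProb_of_numBlocks h, Finset.mul_sum]
  rw [← Finset.sum_fiberwise_of_maps_to hmaps]
  refine Finset.sum_congr rfl fun k _ => Finset.sum_congr rfl fun s hs => ?_
  rw [(Finset.mem_filter.1 hs).2, mul_comm]

end DistinctValues

section Consistency

variable {α θ : ℝ} {ι κ : Type*} [Finite ι] [Finite κ]

theorem gibbsWeight_succ_add (h : IsPitmanYorParam α θ) {n k : ℕ} (hnk : k = 0 ↔ n = 0) :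
    gibbsWeight α θ (n + 1) (k + 1) + (n - k * α) * gibbsWeight α θ (n + 1) k =
      gibbsWeight α θ n k := by
  rcases n with _ | n
  · simp [hnk.2 rfl, gibbsWeight]
  · obtain ⟨k, rfl⟩ := Nat.exists_eq_succ_of_ne_zero (mt hnk.1 n.succ_ne_zero)
    have hr := (rising_pos h.add_one_pos n).ne'
    have hn : θ + 1 + n ≠ 0 := by linarith [h.add_one_pos, Nat.cast_nonneg (α := ℝ) n]
    simp only [gibbsWeight, Nat.succ_eq_add_one, Nat.add_sub_cancel, Finset.prod_range_succ,
      rising_succ]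
    generalize ∏ i ∈ Finset.range k, (θ + ((i : ℝ) + 1) * α) = A
    push_cast
    field_simp
    ring

theorem sum_partitionProb_comap_some (h : IsPitmanYorParam α θ) (u : Setoid ι → ℝ) :
    ∑ t : Setoid (Option ι), partitionProb α θ t * u (t.comap some) =
      ∑ s, partitionProb α θ s * u s := by
  have hsum := sum_setoid_option α fun (s : Setoid ι) k => gibbsWeight α θ (Nat.card ι + 1) k * u s
  convert hsum using 2 with t _ s _
  · rw [partitionProb_eq, Finite.card_option]
    ring
  · rw [partitionProb_eq, ← gibbsWeight_succ_add h (numBlocks_eq_zero_iff s)]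
    ring

theorem sum_partitionProb_comap_equiv (α θ : ℝ) (e : κ ≃ ι) (u : Setoid κ → ℝ) :
    ∑ t : Setoid ι, partitionProb α θ t * u (t.comap e) = ∑ s, partitionProb α θ s * u s := by
  simp_rw [← sum_setoid_comap_equiv e fun s => partitionProb α θ s * u s,
    partitionProb_comap_equiv]

theorem sum_partitionProb_comap_inl (h : IsPitmanYorParam α θ) (n : ℕ) (u : Setoid κ → ℝ) :
    ∑ t : Setoid (κ ⊕ Fin n), partitionProb α θ t * u (t.comap Sum.inl) =
      ∑ s, partitionProb α θ s * u s := by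
  induction n with
  | zero => exact sum_partitionProb_comap_equiv α θ (Equiv.sumEmpty κ (Fin 0)).symm u
  | succ n ih =>
    let e : Option (κ ⊕ Fin n) ≃ κ ⊕ Fin (n + 1) :=
      (Equiv.optionEquivSumPUnit.{0} _).trans <| (Equiv.sumAssoc _ _ _).trans <|
        Equiv.sumCongr (Equiv.refl κ) <|
          (Equiv.optionEquivSumPUnit _).symm.trans (finSuccEquiv n).symm
    exact (sum_partitionProb_comap_equiv α θ e fun s => u ((s.comap some).comap Sum.inl)).trans
      ((sum_partitionProb_comap_some h fun s => u (s.comap Sum.inl)).trans ih)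

theorem sum_partitionProb_comap (h : IsPitmanYorParam α θ) {f : κ → ι} (hf : Function.Injective f)
    (u : Setoid κ → ℝ) :
    ∑ t : Setoid ι, partitionProb α θ t * u (t.comap f) = ∑ s, partitionProb α θ s * u s := by
  classical
  let e : κ ⊕ Fin (Nat.card ↑(Set.range f)ᶜ) ≃ ι :=
    (Equiv.sumCongr (Equiv.ofInjective f hf) (Finite.equivFin _).symm).trans
      (Equiv.Set.sumCompl _)
  rw [← sum_partitionProb_comap_inl h (Nat.card ↑(Set.range f)ᶜ) u,
    ← sum_partitionProb_comap_equiv α θ e]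
  rfl

theorem sum_partitionProb_mul_pow_numBlocks_comap (h : IsPitmanYorParam α θ) {f : κ → ι}
    (hf : Function.Injective f) (x : ℝ) :
    ∑ t : Setoid ι, partitionProb α θ t * x ^ numBlocks (t.comap f) =
      distinctPGF (Nat.card κ) x α θ := by
  rw [← sum_partitionProb_mul_pow_numBlocks h]
  exact sum_partitionProb_comap h hf fun s => x ^ numBlocks s

end Consistency

section BlockRemoval

variable {ι : Type*}

open Classical in
/-- The partition that consists of the block `B` and of the blocks of a partition of the complement
of `B`. -/
noncomputable def glueBlock (B : Finset ι) (s : Setoid {x // x ∉ B}) : Setoid ι :=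
  Setoid.ker fun x => if h : x ∈ B then none else some (⟦⟨x, h⟩⟧ : Quotient s)

theorem comap_glueBlock (B : Finset ι) (s : Setoid {x // x ∉ B}) :
    (glueBlock B s).comap Subtype.val = s := by
  refine Setoid.ext fun x y => ?_
  rw [Setoid.comap_rel, glueBlock, Setoid.ker_def, dif_neg x.2, dif_neg y.2, Option.some_inj,
    Quotient.eq]

theorem glueBlock_iff_mem {B : Finset ι} {a : ι} (ha : a ∈ B) (s : Setoid {x // x ∉ B}) (x : ι) :
    glueBlock B s x a ↔ x ∈ B := by
  rw [glueBlock, Setoid.ker_def, dif_pos ha]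
  by_cases hx : x ∈ B <;> simp [hx]

theorem glueBlock_comap {B : Finset ι} {a : ι} {t : Setoid ι} (h : ∀ x, t x a ↔ x ∈ B) :
    glueBlock B (t.comap Subtype.val) = t := by
  refine Setoid.ext fun x y => ?_
  rw [glueBlock, Setoid.ker_def]
  by_cases hx : x ∈ B <;> by_cases hy : y ∈ B
  · exact iff_of_true (by simp [hx, hy]) (t.trans' ((h x).2 hx) (t.symm' ((h y).2 hy)))
  · exact iff_of_false (by simp [hx, hy]) fun hxy =>
      hy ((h y).1 (t.trans' (t.symm' hxy) ((h x).2 hx)))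
  · exact iff_of_false (by simp [hx, hy]) fun hxy => hx ((h x).1 (t.trans' hxy ((h y).2 hy)))
  · rw [dif_neg hx, dif_neg hy, Option.some_inj, Quotient.eq]
    rfl

open Classical in
theorem sum_setoid_of_block [Finite ι] {B : Finset ι} {a : ι} (ha : a ∈ B) (Φ : Setoid ι → ℝ) :
    ∑ s : Setoid ι with ∀ x, s x a ↔ x ∈ B, Φ s = ∑ s, Φ (glueBlock B s) := by
  refine Finset.sum_nbij' (fun s => s.comap Subtype.val) (glueBlock B)
    (fun _ _ => Finset.mem_univ _) (fun s _ => ?_) (fun s hs => ?_)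
    (fun s _ => comap_glueBlock B s) fun s hs => ?_
  · simpa using glueBlock_iff_mem ha s
  · exact glueBlock_comap (by simpa using hs)
  · rw [glueBlock_comap (by simpa using hs)]

open Classical in
theorem surjective_glueBlock {B : Finset ι} (hB : B.Nonempty) (s : Setoid {x // x ∉ B}) :
    Function.Surjective fun x => if h : x ∈ B then none else some (⟦⟨x, h⟩⟧ : Quotient s) := by
  rintro (_ | q)
  · obtain ⟨a, ha⟩ := hB
    exact ⟨a, dif_pos ha⟩
  · exact ⟨q.out, by simp [q.out.2]⟩

variable [Finite ι]

theorem numBlocks_glueBlock {B : Finset ι} (hB : B.Nonempty) (s : Setoid {x // x ∉ B}) :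
    numBlocks (glueBlock B s) = numBlocks s + 1 := by
  rw [glueBlock, numBlocks_ker_of_surjective (surjective_glueBlock hB s), Finite.card_option,
    numBlocks]

theorem blockProd_glueBlock (α : ℝ) {B : Finset ι} (hB : B.Nonempty) (s : Setoid {x // x ∉ B}) :
    blockProd α (glueBlock B s) = rising (1 - α) (B.card - 1) * blockProd α s := by
  classical
  rw [glueBlock, blockProd_ker α (surjective_glueBlock hB s), Fintype.prod_option, blockProd]
  congr 1
  · have hfiber (x : ι) : (if h : x ∈ B then none else some (⟦⟨x, h⟩⟧ : Quotient s)) = none ↔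
        x ∈ B := by
      simp
    simp_rw [hfiber]
    simp
  · refine Finset.prod_congr rfl fun q _ => ?_
    congr 2
    refine Nat.card_congr ⟨fun x => ⟨⟨x.1, fun hx => ?_⟩, ?_⟩, fun x => ⟨x.1.1, ?_⟩, fun _ => rfl,
      fun _ => rfl⟩
    · simpa [hx] using x.2
    · have h := x.2
      split_ifs at h with hx
      simpa using h
    · simpa [x.1.2] using x.2

open Classical in
theorem sum_partitionProb_of_block {α θ : ℝ} (h : IsPitmanYorParam α θ) {B : Finset ι} {a : ι}
    (ha : a ∈ B) (u : Setoid {x // x ∉ B} → ℝ) :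
    ∑ s : Setoid ι with ∀ x, s x a ↔ x ∈ B, partitionProb α θ s * u (s.comap Subtype.val) =
      rising (1 - α) (B.card - 1) * rising (θ + α) (Nat.card ι - B.card) /
        rising (θ + 1) (Nat.card ι - 1) * ∑ s, partitionProb α (θ + α) s * u s := by
  have hcard : Nat.card {x // x ∉ B} = Nat.card ι - B.card := by
    have := Fintype.ofFinite ι
    simp [Nat.card_eq_fintype_card, Fintype.card_subtype_compl]
  rw [sum_setoid_of_block ha fun s => partitionProb α θ s * u (s.comap Subtype.val),
    Finset.mul_sum]
  refine Finset.sum_congr rfl fun s _ => ?_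
  rw [comap_glueBlock, partitionProb_eq, partitionProb_eq, numBlocks_glueBlock ⟨a, ha⟩,
    blockProd_glueBlock α ⟨a, ha⟩, gibbsWeight, Nat.add_sub_cancel,
    ← rising_mul_gibbsWeight h (numBlocks_eq_zero_iff s).symm, hcard]
  ring

end BlockRemoval

section PartitionSums

variable {ι : Type*} [Fintype ι]

open Classical in
/-- An index vector that induces the partition `s` is an injection of the blocks of `s` into `ℕ`. -/
theorem tsum_prod_of_ker_eq (w : ℕ → ℝ≥0∞) (s : Setoid ι) :
    ∑' I : ι → ℕ, (if Setoid.ker I = s then ∏ i, w (I i) else 0) =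
      distinctSum w (blockCard s) := by
  set g : (Quotient s ↪ ℕ) → ι → ℕ := fun e i => e ⟦i⟧ with hg
  have hker (e) : Setoid.ker (g e) = s :=
    Setoid.ext fun x y => by simp [Setoid.ker_def, hg, Quotient.eq]
  have hinj : Function.Injective g := fun e e' hee' => by
    ext q
    obtain ⟨i, rfl⟩ := Quotient.mk_surjective q
    exact congr_fun hee' i
  rw [← hinj.tsum_eq, distinctSum]
  · refine tsum_congr fun e => ?_
    rw [if_pos (hker e), ← Finset.prod_fiberwise' Finset.univ (Quotient.mk s) fun q => w (e q)]
    refine Finset.prod_congr rfl fun q _ => ?_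
    rw [Finset.prod_const, blockCard, Nat.card_eq_fintype_card, Fintype.card_subtype]
  · intro I hI
    obtain rfl : Setoid.ker I = s := by
      by_contra h
      simp [h] at hI
    exact ⟨⟨Setoid.kerLift I, Setoid.kerLift_injective I⟩, rfl⟩

end PartitionSums

section Sample

variable {V : Type*} [MeasurableSpace V] {n : ℕ}

/-- The joint law of the sticks and of the atoms of the Pitman–Yor process. -/
noncomputable def atomLaw (α θ : ℝ) (ν : Measure V) : Measure ((ℕ → ℝ) × (ℕ → V)) :=
  (stickLaw α θ).prod (Measure.infinitePi fun _ : ℕ => ν)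

/-- The law of `n` independent draws from `stickBreaking p`, as a mixture over the indices `I` of
the atoms that are drawn. -/
noncomputable def drawLaw (n : ℕ) (p : (ℕ → ℝ) × (ℕ → V)) : Measure (Fin n → V) :=
  Measure.sum fun I : Fin n → ℕ => (∏ i, stickWeight p.1 (I i)) • Measure.dirac (p.2 ∘ I)

theorem stickBreaking_apply (p : (ℕ → ℝ) × (ℕ → V)) {s : Set V} (hs : MeasurableSet s) :
    stickBreaking p s = ∑' j, stickWeight p.1 j * s.indicator 1 (p.2 j) := by
  simp only [stickBreaking, Measure.sum_apply _ hs, Measure.smul_apply, smul_eq_mul,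
    Measure.dirac_apply' _ hs, stickWeight]

theorem drawLaw_apply (p : (ℕ → ℝ) × (ℕ → V)) {s : Set (Fin n → V)} (hs : MeasurableSet s) :
    drawLaw n p s = ∑' I, (∏ i, stickWeight p.1 (I i)) * s.indicator 1 (p.2 ∘ I) := by
  simp only [drawLaw, Measure.sum_apply _ hs, Measure.smul_apply, smul_eq_mul,
    Measure.dirac_apply' _ hs]

theorem drawLaw_univ_pi (p : (ℕ → ℝ) × (ℕ → V)) {A : Fin n → Set V}
    (hA : ∀ i, MeasurableSet (A i)) :
    drawLaw n p (Set.univ.pi A) = ∏ i, stickBreaking p (A i) := by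
  simp_rw [stickBreaking_apply p (hA _), prod_tsum_eq_tsum_prod, Finset.prod_mul_distrib,
    drawLaw_apply p (MeasurableSet.univ_pi hA)]
  refine tsum_congr fun I => congrArg _ ?_
  classical
  simp [Set.indicator_apply, Finset.prod_ite_zero]

theorem measurable_drawLaw : Measurable (drawLaw n : (ℕ → ℝ) × (ℕ → V) → _) := by
  refine Measure.measurable_of_measurable_coe _ fun s hs => ?_
  simp_rw [drawLaw_apply _ hs]
  refine Measurable.tsum fun I => Measurable.mul ?_ ?_
  · exact Finset.measurable_fun_prod _ fun i _ => (measurable_stickWeight _).comp measurable_fst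
  · exact (measurable_one.indicator hs).comp (by fun_prop)

variable {α θ : ℝ} {ν : Measure V} {Ω : Type*} [MeasurableSpace Ω] {μ : Measure Ω}
  [IsProbabilityMeasure μ] {P : Ω → Measure V} {X : Fin n → Ω → V}

theorem map_sample_eq_bind (hP : HasLaw P (pypLaw α θ ν) μ) (hX : IsSampleFrom μ X P) :
    μ.map (fun ω i => X i ω) = (atomLaw α θ ν).bind (drawLaw n) := by
  have hXm : Measurable fun ω i => X i ω := measurable_pi_lambda _ hX.1
  have hbox (A : Fin n → Set V) (hA : ∀ i, MeasurableSet (A i)) :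
      μ.map (fun ω i => X i ω) (Set.univ.pi A) =
        (atomLaw α θ ν).bind (drawLaw n) (Set.univ.pi A) := by
    have hQ : Measurable fun Q : Measure V => ∏ i, Q (A i) :=
      Finset.measurable_fun_prod _ fun i _ => Measure.measurable_coe (hA i)
    calc μ.map (fun ω i => X i ω) (Set.univ.pi A) = ∫⁻ ω, ∏ i, P ω (A i) ∂μ := by
          rw [Measure.map_apply hXm (MeasurableSet.univ_pi hA)]
          simpa [Set.pi, Set.preimage] using hX.2 Set.univ A MeasurableSet.univ hA
      _ = ∫⁻ p, ∏ i, stickBreaking p (A i) ∂atomLaw α θ ν := by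
          rw [hP.lintegral_comp (f := fun Q => ∏ i, Q (A i)) hQ.aemeasurable, pypLaw,
            lintegral_map hQ measurable_stickBreaking]
          rfl
      _ = _ := by
          rw [Measure.bind_apply (MeasurableSet.univ_pi hA) measurable_drawLaw.aemeasurable]
          simp_rw [drawLaw_univ_pi _ hA]
  have := Measure.isProbabilityMeasure_map (μ := μ) hXm.aemeasurable
  refine ext_of_generate_finite _ generateFrom_pi.symm isPiSystem_pi ?_ ?_
  · rintro _ ⟨A, hA, rfl⟩
    exact hbox A fun i => hA i (Set.mem_univ i)
  · simpa using hbox (fun _ => Set.univ) fun _ => MeasurableSet.univ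

variable [MeasurableEq V]

theorem ae_infinitePi_injective [IsProbabilityMeasure ν] [NullSingletonClass ν] :
    ∀ᵐ Y ∂Measure.infinitePi fun _ : ℕ => ν, Function.Injective Y := by
  have hdiag : (ν.prod ν) (Set.diagonal V) = 0 := by
    rw [Measure.measure_prod_null measurableSet_diagonal]
    refine .of_forall fun x => ?_
    have : Prod.mk x ⁻¹' Set.diagonal V = {x} := Set.ext fun y => eq_comm
    simp [this]
  have hne (i j : ℕ) (hij : i ≠ j) : ∀ᵐ Y ∂Measure.infinitePi fun _ : ℕ => ν, Y i ≠ Y j := by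
    rw [← Measure.infinitePi_map_eval_prod (P := fun _ : ℕ => ν) hij,
      Measure.map_apply (by fun_prop) measurableSet_diagonal] at hdiag
    exact measure_eq_zero_iff_ae_notMem.1 hdiag
  simp_rw [Function.Injective, ae_all_iff]
  intro i j
  rcases eq_or_ne i j with rfl | hij
  · simp
  · exact (hne i j hij).mono fun Y hY h => absurd h hY

theorem measurableSet_ker_eq {ι : Type*} [Countable ι] (s : Setoid ι) :
    MeasurableSet {x : ι → V | Setoid.ker x = s} := by
  have hker : {x : ι → V | Setoid.ker x = s} = ⋂ i, ⋂ j, {x | x i = x j ↔ s i j} := by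
    ext x
    simp only [Set.mem_ofPred_eq, Set.mem_iInter, Setoid.ext_iff, Setoid.ker_def]
  rw [hker]
  refine MeasurableSet.iInter fun i => MeasurableSet.iInter fun j => ?_
  have heq : MeasurableSet {x : ι → V | x i = x j} :=
    measurableSet_eq_fun (measurable_pi_apply i) (measurable_pi_apply j)
  exact heq.iff (.const _)

theorem drawLaw_ker_eq {p : (ℕ → ℝ) × (ℕ → V)} (hp : Function.Injective p.2)
    (s : Setoid (Fin n)) :
    drawLaw n p {x | Setoid.ker x = s} =
      distinctSum (stickWeight p.1) (blockCard s) := by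
  classical
  have hker (I : Fin n → ℕ) : Setoid.ker (p.2 ∘ I) = Setoid.ker I :=
    Setoid.ext fun i j => hp.eq_iff
  simp [drawLaw_apply p (measurableSet_ker_eq s), Set.indicator_apply, hker,
    ← tsum_prod_of_ker_eq]

theorem measure_ker_sample_eq [IsProbabilityMeasure ν] [NullSingletonClass ν]
    (h : IsPitmanYorParam α θ) (hP : HasLaw P (pypLaw α θ ν) μ) (hX : IsSampleFrom μ X P)
    (s : Setoid (Fin n)) :
    μ {ω | Setoid.ker (fun i => X i ω) = s} = ENNReal.ofReal (partitionProb α θ s) := by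
  have := h.isProbabilityMeasure_stickLaw
  have hXm : Measurable fun ω i => X i ω := measurable_pi_lambda _ hX.1
  have hinj : ∀ᵐ p ∂atomLaw α θ ν, Function.Injective p.2 :=
    Measure.quasiMeasurePreserving_snd.ae ae_infinitePi_injective
  calc μ {ω | Setoid.ker (fun i => X i ω) = s}
      = ∫⁻ p, drawLaw n p {x | Setoid.ker x = s} ∂atomLaw α θ ν := by
        rw [← Measure.bind_apply (measurableSet_ker_eq s) measurable_drawLaw.aemeasurable,
          ← map_sample_eq_bind hP hX, Measure.map_apply hXm (measurableSet_ker_eq s)]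
        rfl
    _ = ∫⁻ p, distinctSum (stickWeight p.1) (blockCard s) ∂atomLaw α θ ν :=
        lintegral_congr_ae (hinj.mono fun p hp => drawLaw_ker_eq hp s)
    _ = ∫⁻ v, distinctSum (stickWeight v) (blockCard s) ∂stickLaw α θ :=
        measurePreserving_fst.lintegral_comp (measurable_distinctSum measurable_stickWeight _)
    _ = ENNReal.ofReal (partitionProb α θ s) := lintegral_distinctSum h (blockCard_ne_zero s)

end Sample

section InclusionExclusion

/-- The alternating binomial sum `∑_{i ≤ d} C(d, i) (-1)^(d - i) a_i`, that is, the `d`-th forward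
difference of the sequence `a` at `0`. -/
noncomputable def binomialDiff (d : ℕ) (a : ℕ → ℝ) : ℝ :=
  ∑ i ∈ Finset.range (d + 1), (d.choose i : ℝ) * (-1) ^ (d - i) * a i

theorem binomialDiff_const_mul (d : ℕ) (k : ℝ) (a : ℕ → ℝ) :
    binomialDiff d (fun i => k * a i) = k * binomialDiff d a := by
  simp only [binomialDiff, Finset.mul_sum]
  exact Finset.sum_congr rfl fun i _ => by ring

theorem binomialDiff_one (d : ℕ) : binomialDiff d (fun _ => 1) = if d = 0 then 1 else 0 := by
  have hpow := add_pow (1 : ℝ) (-1) d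
  simp only [one_pow, one_mul, add_neg_cancel, zero_pow_eq] at hpow
  rw [hpow, binomialDiff]
  exact Finset.sum_congr rfl fun i _ => by ring

theorem sum_choose_mul_choose_eq_binomialDiff (M c : ℕ) (a : ℕ → ℝ) :
    ∑ r ∈ Finset.range (M + 1), (M.choose r : ℝ) * ((-1) ^ (r - c) * r.choose c * a r) =
      M.choose c * binomialDiff (M - c) fun i => a (M - i) := by
  have hsmall {N : ℕ} (hN : N ≤ c) :
      ∑ r ∈ Finset.range N, (M.choose r : ℝ) * ((-1) ^ (r - c) * r.choose c * a r) = 0 :=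
    Finset.sum_eq_zero fun r hr => by
      simp [Nat.choose_eq_zero_of_lt ((Finset.mem_range.1 hr).trans_le hN)]
  rcases lt_or_ge M c with hc | hc
  · rw [hsmall hc, Nat.choose_eq_zero_of_lt hc, Nat.cast_zero, zero_mul]
  obtain ⟨d, rfl⟩ := Nat.exists_eq_add_of_le hc
  rw [add_assoc, Finset.sum_range_add, hsmall le_rfl, zero_add, Nat.add_sub_cancel_left,
    ← Finset.sum_range_reflect, binomialDiff, Finset.mul_sum]
  refine Finset.sum_congr rfl fun i hi => ?_
  have hid : i ≤ d := Finset.mem_range_succ_iff.1 hi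
  have hchoose : ((c + d).choose (c + (d - i)) : ℝ) * (c + (d - i)).choose c =
      (c + d).choose c * d.choose i := by
    have := Nat.choose_mul (n := c + d) (k := c + (d - i)) (s := c) (by omega)
    rw [Nat.add_sub_cancel_left, Nat.add_sub_cancel_left, Nat.choose_symm hid] at this
    exact_mod_cast this
  rw [show d + 1 - 1 - i = d - i by omega, Nat.add_sub_cancel_left,
    show c + d - i = c + (d - i) by omega]
  linear_combination (-1) ^ (d - i) * a (c + (d - i)) * hchoose

theorem sum_powerset_neg_one_pow_mul_choose {ι : Type*} (Z : Finset ι) (c : ℕ) :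
    ∑ R ∈ Z.powerset, (-1) ^ (R.card - c) * (R.card.choose c : ℝ) =
      if Z.card = c then 1 else 0 := by
  rw [Finset.sum_powerset_apply_card fun r => (-1 : ℝ) ^ (r - c) * (r.choose c : ℝ)]
  have hsum := sum_choose_mul_choose_eq_binomialDiff Z.card c fun _ => 1
  simp only [mul_one, binomialDiff_one] at hsum
  simp only [nsmul_eq_mul, hsum]
  rcases lt_trichotomy Z.card c with h | h | h
  · simp [h.ne, Nat.choose_eq_zero_of_lt h]
  · simp [h]
  · rw [if_neg (Nat.sub_ne_zero_of_lt h), if_neg h.ne', mul_zero]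

theorem indicator_inter_card_inter_eq {Ω ι : Type*} [DecidableEq ι] (Z : Ω → Finset ι)
    (U : Finset ι) (E : Set Ω) (c : ℕ) (ω : Ω) :
    (E ∩ {ω | (U ∩ Z ω).card = c}).indicator (1 : Ω → ℝ) ω =
      ∑ R ∈ U.powerset, (-1) ^ (R.card - c) * (R.card.choose c : ℝ) *
        (E ∩ {ω | R ⊆ Z ω}).indicator (1 : Ω → ℝ) ω := by
  classical
  by_cases hω : ω ∈ E
  · have hfilter : U.powerset.filter (· ⊆ Z ω) = (U ∩ Z ω).powerset := by
      ext R
      simp only [Finset.mem_filter, Finset.mem_powerset, Finset.subset_inter_iff]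
    have hsum := sum_powerset_neg_one_pow_mul_choose (U ∩ Z ω) c
    rw [← hfilter, Finset.sum_filter] at hsum
    simp only [Set.indicator_apply, Set.mem_inter_iff, hω, true_and, Set.mem_ofPred_eq,
      Pi.one_apply, mul_ite, mul_one, mul_zero]
    exact hsum.symm
  · simp [Set.indicator, hω]

variable {Ω ι : Type*} [MeasurableSpace Ω] {μ : Measure Ω} [IsFiniteMeasure μ]

theorem measureReal_inter_eq_sum_fiber [Fintype ι] {g : Ω → ι}
    (hg : ∀ i, MeasurableSet {ω | g ω = i}) {F : Set Ω} (hF : MeasurableSet F) (p : ι → Prop)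
    [DecidablePred p] :
    μ.real ({ω | p (g ω)} ∩ F) = ∑ i with p i, μ.real ({ω | g ω = i} ∩ F) := by
  rw [← measureReal_biUnion_finset]
  · congr 1
    ext ω
    simp
  · intro i _ j _ hij
    exact Set.disjoint_left.2 fun ω hi hj => hij (hi.1.symm.trans hj.1)
  · exact fun i _ => (hg i).inter hF

variable [Finite ι]

theorem measurableSet_finset_of_mem {Z : Ω → Finset ι}
    (hZ : ∀ i, MeasurableSet {ω | i ∈ Z ω}) (p : Finset ι → Prop) :
    MeasurableSet {ω | p (Z ω)} := by
  have hfibers : {ω | p (Z ω)} = ⋃ F ∈ {F | p F}, ⋂ i, {ω | i ∈ Z ω ↔ i ∈ F} := by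
    ext ω
    simp only [Set.mem_ofPred_eq, Set.mem_iUnion, Set.mem_iInter, exists_prop]
    exact ⟨fun H => ⟨Z ω, H, fun _ => Iff.rfl⟩, fun ⟨F, hF, H⟩ => by rwa [Finset.ext H]⟩
  rw [hfibers]
  exact .biUnion (Set.to_countable _) fun F _ => .iInter fun i => (hZ i).iff (.const _)

theorem measureReal_inter_card_inter_eq [DecidableEq ι] {Z : Ω → Finset ι}
    (hZ : ∀ i, MeasurableSet {ω | i ∈ Z ω}) {E : Set Ω} (hE : MeasurableSet E) {U : Finset ι}
    {a : ℕ → ℝ} (ha : ∀ R ⊆ U, μ.real (E ∩ {ω | R ⊆ Z ω}) = a R.card) (c : ℕ) :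
    μ.real (E ∩ {ω | (U ∩ Z ω).card = c}) =
      U.card.choose c * binomialDiff (U.card - c) fun i => a (U.card - i) := by
  have hm (p : Finset ι → Prop) : MeasurableSet (E ∩ {ω | p (Z ω)}) :=
    hE.inter (measurableSet_finset_of_mem hZ p)
  calc μ.real (E ∩ {ω | (U ∩ Z ω).card = c})
      = ∑ R ∈ U.powerset, (-1) ^ (R.card - c) * (R.card.choose c : ℝ) *
          μ.real (E ∩ {ω | R ⊆ Z ω}) := by
        rw [← integral_indicator_one (hm fun F => (U ∩ F).card = c)]
        simp_rw [indicator_inter_card_inter_eq]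
        rw [integral_finsetSum _ fun R _ =>
          by exact ((integrable_const (1 : ℝ)).indicator (hm fun F => R ⊆ F)).const_mul _]
        exact Finset.sum_congr rfl fun R _ => by
          rw [integral_const_mul, integral_indicator_one (hm fun F => R ⊆ F)]
    _ = ∑ R ∈ U.powerset, (-1) ^ (R.card - c) * (R.card.choose c : ℝ) * a R.card :=
        Finset.sum_congr rfl fun R hR => by rw [ha R (Finset.mem_powerset.1 hR)]
    _ = _ := by
        rw [Finset.sum_powerset_apply_card
          fun r => (-1 : ℝ) ^ (r - c) * (r.choose c : ℝ) * a r]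
        simp only [nsmul_eq_mul, sum_choose_mul_choose_eq_binomialDiff]

end InclusionExclusion

section AgreeSet

variable {ι E : Type*} [Fintype ι]

open Classical in
/-- The set of indices at which the family `x` has the same value as at the index `a`. Its size is
the frequency of the value `x a`. -/
noncomputable def agreeSet (x : ι → E) (a : ι) : Finset ι := Finset.univ.filter fun i => x i = x a

@[simp]
theorem mem_agreeSet {x : ι → E} {a i : ι} : i ∈ agreeSet x a ↔ x i = x a := by
  simp [agreeSet]

theorem subset_agreeSet {x : ι → E} {a : ι} {R : Finset ι} :
    R ⊆ agreeSet x a ↔ ∀ i ∈ R, x i = x a := by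
  simp [Finset.subset_iff]

theorem agreeSet_subset_agreeSet_comp {F : Type*} (x : ι → E) (h : E → F) (a : ι) :
    agreeSet x a ⊆ agreeSet (fun i => h (x i)) a := fun i hi => by
  rw [mem_agreeSet] at hi ⊢
  rw [hi]

theorem agreeSet_eq_iff {x : ι → E} {a : ι} {B : Finset ι} :
    agreeSet x a = B ↔ ∀ i, Setoid.ker x i a ↔ i ∈ B := by
  simp [Finset.ext_iff, Setoid.ker_def]

end AgreeSet

section Hash

variable {Ω V ι κ : Type*} [MeasurableSpace Ω] [MeasurableSpace V] {μ : Measure Ω} {J : ℕ}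
  {X : ι → Ω → V} {h : Ω → V → Fin J}

theorem IsPerfectlyRandomHash.measurable_hash (hh : IsPerfectlyRandomHash μ (fun ω i => X i ω) h)
    (i : ι) : Measurable fun ω => h ω (X i ω) :=
  hh.1 (fun x => x i) (measurable_pi_apply i)

variable [MeasurableEq V] [Countable ι]

theorem measurableSet_ker_sample_eq (hX : ∀ i, Measurable (X i)) (s : Setoid ι) :
    MeasurableSet {ω | Setoid.ker (fun i => X i ω) = s} :=
  measurable_pi_lambda _ hX (measurableSet_ker_eq s)

variable [Finite κ]

theorem IsPerfectlyRandomHash.measure_ker_eq_inter_forall_eq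
    (hh : IsPerfectlyRandomHash μ (fun ω i => X i ω) h) (s : Setoid ι) (f : κ → ι) (j : Fin J) :
    μ ({ω | Setoid.ker (fun i => X i ω) = s} ∩ {ω | ∀ x, h ω (X (f x) ω) = j}) =
      μ {ω | Setoid.ker (fun i => X i ω) = s} * (J : ℝ≥0∞)⁻¹ ^ numBlocks (s.comap f) := by
  set t : Setoid κ := s.comap f
  let e : Quotient t ≃ Fin (numBlocks t) := Finite.equivFin _
  let r (b : Fin (numBlocks t)) : ι := f (e.symm b).out
  have hr (x : κ) : s (r (e ⟦x⟧)) (f x) := by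
    have : t (⟦x⟧ : Quotient t).out x := Quotient.mk_out x
    simp only [r, Equiv.symm_apply_apply]
    exact this
  have hinj {x : ι → V} (hx : Setoid.ker x = s) : Function.Injective fun b => x (r b) := by
    intro b b' hbb
    have : s (r b) (r b') := hx ▸ hbb
    exact e.symm.injective (Quotient.out_equiv_out.1 this)
  refine Eq.trans ?_ (hh.2 (numBlocks t) (fun b x => x (r b)) {x | Setoid.ker x = s}
    (fun b => measurable_pi_apply _) (measurableSet_ker_eq s) (fun x hx => hinj hx) fun _ => j)
  congr 1
  ext ω
  refine and_congr_right fun hω => ⟨fun H b => H _, fun H x => ?_⟩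
  have hX : X (r (e ⟦x⟧)) ω = X (f x) ω := by
    have := hr x
    rwa [← show Setoid.ker (fun i => X i ω) = s from hω] at this
  exact hX ▸ H (e ⟦x⟧)

theorem IsPerfectlyRandomHash.measure_ker_eq_inter_same_bucket (hX : ∀ i, Measurable (X i))
    (hh : IsPerfectlyRandomHash μ (fun ω i => X i ω) h) (s : Setoid ι) (f : κ → ι) (a : κ) :
    μ ({ω | Setoid.ker (fun i => X i ω) = s} ∩
        {ω | ∀ x, h ω (X (f x) ω) = h ω (X (f a) ω)}) =
      μ {ω | Setoid.ker (fun i => X i ω) = s} * (J * (J : ℝ≥0∞)⁻¹ ^ numBlocks (s.comap f)) := by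
  have hbuckets : {ω | ∀ x, h ω (X (f x) ω) = h ω (X (f a) ω)} =
      ⋃ j : Fin J, {ω | ∀ x, h ω (X (f x) ω) = j} := by
    ext ω
    simp only [Set.mem_ofPred_eq, Set.mem_iUnion]
    exact ⟨fun H => ⟨_, H⟩, fun ⟨j, H⟩ x => (H x).trans (H a).symm⟩
  rw [hbuckets, Set.inter_iUnion, measure_iUnion, tsum_fintype]
  · simp only [hh.measure_ker_eq_inter_forall_eq, Finset.sum_const, Finset.card_univ,
      Fintype.card_fin, nsmul_eq_mul]
    ring
  · intro j j' hjj
    exact Set.disjoint_left.2 fun ω h1 h2 => hjj ((h1.2 a).symm.trans (h2.2 a))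
  · intro j
    refine (measurableSet_ker_sample_eq hX s).inter ?_
    rw [Set.ofPred_forall]
    exact .iInter fun x => hh.measurable_hash (f x) (measurableSet_singleton j)

end Hash

section Buckets

variable {Ω V : Type*} [MeasurableSpace Ω] [MeasurableSpace V] {μ : Measure Ω} {n J : ℕ}
  {X : Fin n → Ω → V} {h : Ω → V → Fin J}

theorem measurableSet_mem_agreeSet [MeasurableEq V] (hX : ∀ i, Measurable (X i)) (a i : Fin n) :
    MeasurableSet {ω | i ∈ agreeSet (fun i => X i ω) a} := by
  simpa only [mem_agreeSet] using measurableSet_eq_fun (hX i) (hX a)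

variable [MeasurableEq V] [IsProbabilityMeasure μ] {ν : Measure V} [IsProbabilityMeasure ν]
  [NullSingletonClass ν] {α θ : ℝ} {P : Ω → Measure V}

theorem measureReal_ker_sample_eq (hp : IsPitmanYorParam α θ) (hP : HasLaw P (pypLaw α θ ν) μ)
    (hX : IsSampleFrom μ X P) (s : Setoid (Fin n)) :
    μ.real {ω | Setoid.ker (fun i => X i ω) = s} = partitionProb α θ s := by
  rw [measureReal_def, measure_ker_sample_eq hp hP hX,
    ENNReal.toReal_ofReal (partitionProb_nonneg hp s)]

variable (hp : IsPitmanYorParam α θ) (hP : HasLaw P (pypLaw α θ ν) μ) (hX : IsSampleFrom μ X P)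
  (hh : IsPerfectlyRandomHash μ (fun ω i => X i ω) h)

include hp hP hX

theorem measureReal_ncard_range_eq (k : ℕ) :
    μ.real {ω | (Set.range fun i => X i ω).ncard = k} = distinctPMF α θ n k := by
  classical
  have hfibers := measureReal_inter_eq_sum_fiber (μ := μ) (measurableSet_ker_sample_eq hX.1) .univ
    fun s => numBlocks s = k
  simp only [Set.inter_univ, numBlocks_ker, measureReal_ker_sample_eq hp hP hX] at hfibers
  rw [hfibers]
  convert sum_partitionProb_of_numBlocks hp (Fin n) k
  exact (Nat.card_fin n).symm

include hh

open Classical in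
theorem measureReal_ker_inter_same_bucket (p : Setoid (Fin n) → Prop) (R : Finset (Fin n))
    (a : Fin n) :
    μ.real ({ω | p (Setoid.ker fun i => X i ω)} ∩
        {ω | R ⊆ agreeSet (fun i => h ω (X i ω)) a}) =
      ∑ s with p s, partitionProb α θ s *
        (J * (1 / J) ^ numBlocks (s.comap fun o : Option R => o.elim a Subtype.val)) := by
  have hR : MeasurableSet {ω | R ⊆ agreeSet (fun i => h ω (X i ω)) a} :=
    measurableSet_finset_of_mem (measurableSet_mem_agreeSet hh.measurable_hash a) (R ⊆ ·)
  rw [measureReal_inter_eq_sum_fiber (measurableSet_ker_sample_eq hX.1) hR]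
  refine Finset.sum_congr rfl fun s _ => ?_
  have hset : {ω | R ⊆ agreeSet (fun i => h ω (X i ω)) a} =
      {ω | ∀ o : Option R, h ω (X (o.elim a Subtype.val) ω) =
        h ω (X ((none : Option R).elim a Subtype.val) ω)} := by
    ext ω
    simp [subset_agreeSet, Option.forall]
  rw [hset, measureReal_def, hh.measure_ker_eq_inter_same_bucket hX.1, ENNReal.toReal_mul,
    ← measureReal_def, measureReal_ker_sample_eq hp hP hX, ENNReal.toReal_mul,
    ENNReal.toReal_pow, ENNReal.toReal_inv, ENNReal.toReal_natCast, one_div]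

theorem measureReal_subset_bucket {R : Finset (Fin n)} {a : Fin n} (ha : a ∉ R) :
    μ.real {ω | R ⊆ agreeSet (fun i => h ω (X i ω)) a} =
      J * distinctPGF (R.card + 1) (1 / J) α θ := by
  have hinj : Function.Injective fun o : Option R => o.elim a Subtype.val :=
    Option.injective_iff.2 ⟨Subtype.val_injective, by simpa using ha⟩
  have hsum := measureReal_ker_inter_same_bucket hp hP hX hh (fun _ => True) R a
  rw [Set.ofPred_true, Set.univ_inter, Finset.filter_true] at hsum
  have hcard : Nat.card (Option R) = R.card + 1 := by simp
  rw [hsum, ← hcard, ← sum_partitionProb_mul_pow_numBlocks_comap hp hinj, Finset.mul_sum]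
  exact Finset.sum_congr rfl fun s _ => by ring

theorem measureReal_block_inter_subset_bucket (hJ : 0 < J) {B R : Finset (Fin n)} {a : Fin n}
    (ha : a ∈ B) (hRB : R ⊆ Bᶜ) :
    μ.real ({ω | agreeSet (fun i => X i ω) a = B} ∩
        {ω | R ⊆ agreeSet (fun i => h ω (X i ω)) a}) =
      rising (1 - α) (B.card - 1) * rising (θ + α) (n - B.card) / rising (θ + 1) (n - 1) *
        distinctPGF R.card (1 / J) α (θ + α) := by
  let g (x : R) : {x // x ∉ B} := ⟨x, Finset.mem_compl.1 (hRB x.2)⟩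
  have hg : Function.Injective g := fun x y hxy => Subtype.ext (congrArg (fun z => z.1) hxy)
  have hblocks (s : Setoid (Fin n)) (hs : ∀ x, s x a ↔ x ∈ B) :
      numBlocks (s.comap fun o : Option R => o.elim a Subtype.val) =
        numBlocks ((s.comap (Subtype.val : {x // x ∉ B} → Fin n)).comap g) + 1 := by
    rw [← numBlocks_extendSetoid_none]
    congr 1
    refine setoid_option_ext (by rw [comap_extendSetoid]; rfl) fun x => ?_
    rw [extendSetoid_none_some]
    simp only [reduceCtorEq, iff_false]
    exact fun h => (g x).2 ((hs x).1 (s.symm' h))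
  have hsum := measureReal_ker_inter_same_bucket hp hP hX hh (fun s => ∀ x, s x a ↔ x ∈ B) R a
  simp only [← agreeSet_eq_iff] at hsum
  rw [hsum, ← Nat.card_eq_finsetCard R, ← sum_partitionProb_mul_pow_numBlocks_comap hp.add_self hg]
  have hblock := sum_partitionProb_of_block hp ha
    fun u : Setoid {x // x ∉ B} => (1 / J : ℝ) ^ numBlocks (u.comap g)
  rw [Nat.card_fin] at hblock
  rw [← hblock]
  refine Finset.sum_congr rfl fun s hs => ?_
  have hs : ∀ x, s x a ↔ x ∈ B := by simpa using hs
  rw [hblocks s hs, pow_succ']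
  field_simp

end Buckets

section Counts

theorem thetaFactor_eq (θ : ℝ) (m : ℕ) : thetaFactor θ m = 1 / rising (θ + 1) m := by
  rw [thetaFactor]
  split_ifs with h
  · rw [h, zero_add]
  · rw [rising_succ_left, div_mul_eq_div_div, div_self h]

variable {V : Type*} {m J : ℕ}

theorem sum_indicator_castSucc_add_one {E : Type*} (y : Fin (m + 1) → E) :
    ∑ i : Fin m, Set.indicator {y i.castSucc} (fun _ => 1) (y (Fin.last m)) + 1 =
      (agreeSet y (Fin.last m)).card := by
  classical
  rw [agreeSet, Finset.card_filter, Fin.sum_univ_castSucc, if_pos rfl]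
  simp only [Set.indicator_apply, Set.mem_singleton_iff, eq_comm]

theorem freq_eq_iff (x : Fin (m + 1) → V) (l : ℕ) :
    freq (fun i : Fin m => x i.castSucc) (x (Fin.last m)) = l ↔
      (agreeSet x (Fin.last m)).card = l + 1 := by
  rw [← sum_indicator_castSucc_add_one, Nat.add_left_inj, freq]

theorem bucketCount_eq_iff (h : V → Fin J) (x : Fin (m + 1) → V) (c : ℕ) :
    bucketCount h (fun i : Fin m => x i.castSucc) (x (Fin.last m)) = c ↔
      (agreeSet (fun i => h (x i)) (Fin.last m)).card = c + 1 := by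
  rw [← sum_indicator_castSucc_add_one, Nat.add_left_inj, bucketCount]

theorem card_filter_mem_and_card_eq {ι : Type*} [Fintype ι] [DecidableEq ι] (a : ι) (l : ℕ) :
    (Finset.univ.filter fun B : Finset ι => a ∈ B ∧ B.card = l + 1).card =
      (Fintype.card ι - 1).choose l := by
  have hsub := Finset.card_filter_powersetCard_subset {a} Finset.univ (l + 1)
    (Finset.subset_univ _) (by simp)
  rw [Finset.powersetCard_eq_filter, Finset.filter_filter, Finset.powerset_univ] at hsub
  simpa only [Finset.singleton_subset_iff, and_comm, Finset.card_univ, Finset.card_singleton,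
    Nat.add_sub_cancel] using hsub

end Counts

section JointLaw

variable {Ω V : Type*} [MeasurableSpace Ω] [MeasurableSpace V] {μ : Measure Ω} {m J : ℕ}
  {X : Fin (m + 1) → Ω → V} {h : Ω → V → Fin J}

theorem measurableSet_bucketCount_eq (hh : IsPerfectlyRandomHash μ (fun ω i => X i ω) h) (c : ℕ) :
    MeasurableSet
      {ω | bucketCount (h ω) (fun i : Fin m => X i.castSucc ω) (X (Fin.last m) ω) = c} := by
  simp_rw [fun ω => bucketCount_eq_iff (h ω) (fun i => X i ω) c]
  exact measurableSet_finset_of_mem (measurableSet_mem_agreeSet hh.measurable_hash _)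
    fun F => F.card = c + 1

variable [MeasurableEq V] [IsProbabilityMeasure μ] {ν : Measure V} [IsProbabilityMeasure ν]
  [NullSingletonClass ν] {α θ : ℝ} {P : Ω → Measure V}

variable (hp : IsPitmanYorParam α θ) (hP : HasLaw P (pypLaw α θ ν) μ) (hX : IsSampleFrom μ X P)
  (hh : IsPerfectlyRandomHash μ (fun ω i => X i ω) h)

include hp hP hX hh

theorem measureReal_bucketCount_eq (c : ℕ) :
    μ.real {ω | bucketCount (h ω) (fun i : Fin m => X i.castSucc ω) (X (Fin.last m) ω) = c} =
      J * m.choose c * binomialDiff (m - c) fun i => distinctPGF (m - i + 1) (1 / J) α θ := by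
  simp_rw [fun ω => bucketCount_eq_iff (h ω) (fun i => X i ω) c]
  have hcard (ω : Ω) : (agreeSet (fun i => h ω (X i ω)) (Fin.last m)).card = c + 1 ↔
      ({Fin.last m}ᶜ ∩ agreeSet (fun i => h ω (X i ω)) (Fin.last m)).card = c := by
    rw [Finset.inter_comm, ← Finset.sdiff_eq_inter_compl, ← Finset.erase_eq,
      ← Finset.card_erase_add_one (mem_agreeSet.2 rfl), Nat.add_left_inj]
  have hlaw := measureReal_inter_card_inter_eq (μ := μ) (E := Set.univ) (U := {Fin.last m}ᶜ)
    (measurableSet_mem_agreeSet hh.measurable_hash (Fin.last m)) .univ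
    (a := fun r => J * distinctPGF (r + 1) (1 / J) α θ) (fun R hR => by
      rw [Set.univ_inter, measureReal_subset_bucket hp hP hX hh]
      exact fun hlast => by simpa using hR hlast) c
  rw [Set.univ_inter, Finset.card_compl, Finset.card_singleton, Fintype.card_fin,
    Nat.add_sub_cancel, binomialDiff_const_mul] at hlaw
  simp_rw [hcard]
  rw [hlaw]
  ring

theorem measureReal_block_inter_card_bucket (hJ : 0 < J) {B : Finset (Fin (m + 1))}
    {a : Fin (m + 1)} (ha : a ∈ B) {c l : ℕ} (hB : B.card = l + 1) (hl : l ≤ c) :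
    μ.real ({ω | agreeSet (fun i => X i ω) a = B} ∩
        {ω | (agreeSet (fun i => h ω (X i ω)) a).card = c + 1}) =
      (m - l).choose (c - l) *
        (rising (1 - α) l * rising (θ + α) (m - l) / rising (θ + 1) m *
          binomialDiff (m - c) fun i => distinctPGF (m - l - i) (1 / J) α (θ + α)) := by
  have hcard : {ω | agreeSet (fun i => X i ω) a = B} ∩
        {ω | (agreeSet (fun i => h ω (X i ω)) a).card = c + 1} =
      {ω | agreeSet (fun i => X i ω) a = B} ∩
        {ω | (Bᶜ ∩ agreeSet (fun i => h ω (X i ω)) a).card = c - l} := by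
    ext ω
    refine and_congr_right fun hω => ?_
    have hsub : B ⊆ agreeSet (fun i => h ω (X i ω)) a :=
      hω ▸ agreeSet_subset_agreeSet_comp (fun i => X i ω) (h ω) a
    have := Finset.card_sdiff_add_card_eq_card hsub
    rw [Set.mem_ofPred_eq, Set.mem_ofPred_eq, Finset.inter_comm, ← Finset.sdiff_eq_inter_compl]
    omega
  have hBm : Bᶜ.card = m - l := by
    rw [Finset.card_compl, Fintype.card_fin, hB, Nat.add_sub_add_right]
  have hsubset (R : Finset (Fin (m + 1))) (hR : R ⊆ Bᶜ) :=
    measureReal_block_inter_subset_bucket hp hP hX hh hJ ha hR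
  simp only [hB, Nat.add_sub_cancel, Nat.add_sub_add_right] at hsubset
  rw [hcard, measureReal_inter_card_inter_eq
    (measurableSet_mem_agreeSet hh.measurable_hash a)
    (measurableSet_finset_of_mem (measurableSet_mem_agreeSet hX.1 a) (· = B))
    (a := fun r => rising (1 - α) l * rising (θ + α) (m - l) / rising (θ + 1) m *
      distinctPGF r (1 / J) α (θ + α)) hsubset, hBm, binomialDiff_const_mul,
    Nat.sub_sub_sub_cancel_right hl]

theorem measureReal_card_block_inter_card_bucket (hJ : 0 < J) (a : Fin (m + 1)) {c l : ℕ}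
    (hl : l ≤ c) :
    μ.real ({ω | (agreeSet (fun i => X i ω) a).card = l + 1} ∩
        {ω | (agreeSet (fun i => h ω (X i ω)) a).card = c + 1}) =
      m.choose l * (m - l).choose (c - l) *
        (rising (1 - α) l * rising (θ + α) (m - l) / rising (θ + 1) m *
          binomialDiff (m - c) fun i => distinctPGF (m - l - i) (1 / J) α (θ + α)) := by
  have hmem : {ω | (agreeSet (fun i => X i ω) a).card = l + 1} =
      {ω | a ∈ agreeSet (fun i => X i ω) a ∧ (agreeSet (fun i => X i ω) a).card = l + 1} := by
    simp only [mem_agreeSet, true_and]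
  have hblock (B : Finset (Fin (m + 1))) :
      MeasurableSet {ω | agreeSet (fun i => X i ω) a = B} :=
    measurableSet_finset_of_mem (measurableSet_mem_agreeSet hX.1 a) (· = B)
  have hbucket : MeasurableSet {ω | (agreeSet (fun i => h ω (X i ω)) a).card = c + 1} :=
    measurableSet_finset_of_mem (measurableSet_mem_agreeSet hh.measurable_hash a)
      fun F => F.card = c + 1
  rw [hmem, measureReal_inter_eq_sum_fiber hblock hbucket fun B => a ∈ B ∧ B.card = l + 1,
    Finset.sum_congr rfl fun B hB => by
      obtain ⟨ha, hB⟩ := (Finset.mem_filter_univ B).1 hB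
      exact measureReal_block_inter_card_bucket hp hP hX hh hJ ha hB hl,
    Finset.sum_const, card_filter_mem_and_card_eq, Fintype.card_fin, Nat.add_sub_cancel,
    nsmul_eq_mul, mul_assoc]

theorem measureReal_freq_inter_bucketCount_eq (hJ : 0 < J) (c l : ℕ) :
    μ.real ({ω | freq (fun i : Fin m => X i.castSucc ω) (X (Fin.last m) ω) = l} ∩
        {ω | bucketCount (h ω) (fun i : Fin m => X i.castSucc ω) (X (Fin.last m) ω) = c}) =
      m.choose c * c.choose l *
        (rising (1 - α) l * rising (θ + α) (m - l) / rising (θ + 1) m *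
          binomialDiff (m - c) fun i => distinctPGF (m - l - i) (1 / J) α (θ + α)) := by
  simp_rw [fun ω => freq_eq_iff (fun i => X i ω) l,
    fun ω => bucketCount_eq_iff (h ω) (fun i => X i ω) c]
  rcases lt_or_ge c l with hlc | hlc
  · rw [Nat.choose_eq_zero_of_lt hlc, Nat.cast_zero, mul_zero, zero_mul]
    convert measureReal_empty
    refine Set.eq_empty_of_forall_notMem fun ω ⟨hfreq, hbucket⟩ => ?_
    have hle := Finset.card_le_card
      (agreeSet_subset_agreeSet_comp (fun i => X i ω) (h ω) (Fin.last m))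
    rw [Set.mem_ofPred_eq] at hfreq hbucket
    omega
  · have hchoose : (m.choose c : ℝ) * c.choose l = m.choose l * (m - l).choose (c - l) := by
      exact_mod_cast Nat.choose_mul hlc
    rw [measureReal_card_block_inter_card_bucket hp hP hX hh hJ _ hlc, hchoose]

end JointLaw

end PYPSketch

theorem theorem2 {Ω V : Type*} [MeasurableSpace Ω] [MeasurableSpace V] [MeasurableEq V]
    (μ : Measure Ω) [IsProbabilityMeasure μ] (ν : Measure V) [IsProbabilityMeasure ν] [NullSingletonClass ν]
    (α θ : ℝ) (hα0 : 0 ≤ α) (hα1 : α < 1) (hθ : -α < θ)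
    (m J : ℕ) (hJ : 0 < J)
    (P : Ω → Measure V) (hP : HasLaw P (PYPSketch.pypLaw α θ ν) μ)
    (X : Fin (m + 1) → Ω → V) (hX : PYPSketch.IsSampleFrom μ X P)
    (h : Ω → V → Fin J) (hh : PYPSketch.IsPerfectlyRandomHash μ (fun ω i => X i ω) h)
    (f C : Ω → ℕ)
    (hf : ∀ ω, f ω = PYPSketch.freq (fun i : Fin m => X i.castSucc ω) (X (Fin.last m) ω))
    (hC : ∀ ω, C ω =
      PYPSketch.bucketCount (h ω) (fun i : Fin m => X i.castSucc ω) (X (Fin.last m) ω)) :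
    (∀ k : ℕ, μ.real {ω | (Set.range fun i => X i ω).ncard = k} =
      PYPSketch.distinctPMF α θ (m + 1) k) ∧
    ∀ c : ℕ, μ {ω | C ω = c} ≠ 0 →
      (∑ i ∈ Finset.range (m - c + 1), ((m - c).choose i : ℝ) * (-1) ^ (m - c - i) *
          PYPSketch.distinctPGF (m - i + 1) (1 / J) α θ) ≠ 0 ∧
      ∀ l : ℕ, (ProbabilityTheory.cond μ {ω | C ω = c}).real {ω | f ω = l} =
        PYPSketch.thetaFactor θ m / J * (c.choose l : ℝ) *
          PYPSketch.rising (θ + α) (m - l) * PYPSketch.rising (1 - α) l *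
          ((∑ i ∈ Finset.range (m - c + 1), ((m - c).choose i : ℝ) * (-1) ^ (m - c - i) *
              PYPSketch.distinctPGF (m - l - i) (1 / J) α (θ + α)) /
            (∑ i ∈ Finset.range (m - c + 1), ((m - c).choose i : ℝ) * (-1) ^ (m - c - i) *
              PYPSketch.distinctPGF (m - i + 1) (1 / J) α θ)) := by
  have hp : PYPSketch.IsPitmanYorParam α θ := ⟨hα0, hα1, hθ⟩
  obtain rfl : f = _ := funext hf
  obtain rfl : C = _ := funext hC
  refine ⟨PYPSketch.measureReal_ncard_range_eq hp hP hX, fun c hc => ?_⟩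
  have hbucket := PYPSketch.measureReal_bucketCount_eq hp hP hX hh c
  have hne := hbucket ▸ (measureReal_ne_zero_iff).2 hc
  have hdiff := right_ne_zero_of_mul hne
  refine ⟨hdiff, fun l => ?_⟩
  rw [measureReal_def, ProbabilityTheory.cond_apply (PYPSketch.measurableSet_bucketCount_eq hh c),
    ENNReal.toReal_mul, ENNReal.toReal_inv, ← measureReal_def, ← measureReal_def, Set.inter_comm,
    PYPSketch.measureReal_freq_inter_bucketCount_eq hp hP hX hh hJ, hbucket,
    PYPSketch.thetaFactor_eq]
  have hchoose : (m.choose c : ℝ) ≠ 0 := right_ne_zero_of_mul (left_ne_zero_of_mul hne)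
  have hrising := (PYPSketch.rising_pos hp.add_one_pos m).ne'
  simp only [PYPSketch.binomialDiff] at hdiff ⊢
  field_simp
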